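/- **Setting.** Let $\mathcal S,\mathcal A$ be finite non-empty sets with $S=|\mathcal S|$, $A=|\mathcal A|$, let $H,K\ge 1$ be integers and let $\beta\neq 0$ be real. An episodic MDP with horizon $H$ is given by transition kernels $P_h(\cdot\mid s,a)$ and deterministic rewards $r_h(s,a)\in[0,1]$, $h\in[H]$. A policy is $\pi=(\pi_h)_{h\in[H]}$ with $\pi_h:\mathcal S\to\mathcal A$; its value is $$V_h^\pi(s)=\frac1\beta\log \mathbb E\Big[e^{\beta\sum_{i=h}^H r_i(s_i,\pi_i(s_i))}\,\Big|\,s_h=s\Big],\qquad V_h^*(s)=\sup_\pi V_h^\pi(s).$$ The agent plays $K$ episodes, all starting in the same state $s_1$. In episode $k$ it uses a policy $\pi^k$ determined by the past episodes, and its regret is $\mathrm{Reg}(K)=\sum_{k=1}^K\big(V_1^*(s_1)-V_1^{\pi^k}(s_1)\big)$. **Algorithm RSVI2** (inputs $K$, $\beta$, $\delta$ and a constant $c>0$). At the start of episode $k$ let $N_h(s,a)$ be the number of past episodes $\tau<k$ with $(s_h^\tau,a_h^\tau)=(s,a)$. Set $V_{H+1}=0$ and, for $h=H,\dots,1$, set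 $G_h(s,a)=e^{\beta(H-h+1)}$ if $N_h(s,a)=0$, and otherwise $$w_h(s,a)=\frac1{N_h(s,a)}\sum_{\tau<k}\mathbf 1\{(s_h^\tau,a_h^\tau)=(s,a)\}\,e^{\beta[r_h(s,a)+V_{h+1}(s_{h+1}^\tau)]},$$ $$b_h(s,a)=c\,\big|e^{\beta(H-h+1)}-1\big|\sqrt{\frac{S\log(HSAK/\delta)}{N_h(s,a)}},$$ $$G_h(s,a)=\begin{cases}\min\{w_h(s,a)+b_h(s,a),\,e^{\beta(H-h+1)}\},&\beta>0,\\ \max\{w_h(s,a)-b_h(s,a),\,e^{\beta(H-h+1)}\},&\beta<0;\end{cases}$$ then $V_h(s)=\max_{a}\frac1\beta\log G_h(s,a)$. The policy of episode $k$ is $\pi_h^k(s)\in\arg\max_a\frac1\beta\log G_h(s,a)$, ties being broken in any way that depends on the past episodes only. **Theorem 1.** There are universal constants $c,C>0$ such that for all $\mathcal S,\mathcal A,H,K,\beta\ne0$, every MDP as above, every initial state $s_1$ and every $\delta\in(0,1]$, with probability at least $1-\delta$ the regret of RSVI2 run with the constant $c$ satisfies $$\mathrm{Reg}(K)\le C\cdot\frac{e^{|\beta|H}-1}{|\beta|H}\sqrt{H^4S^2AK\,\log^2(HSAK/\delta)}.$$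 -/

import Mathlib

namespace RiskRL

/-- An episodic Markov decision process with horizon `H`, transition kernels `P` and deterministic
rewards in `[0, 1]`. The step `h : Fin H` is counted from `0`, so it is the step `h + 1` of the
usual numbering `1, …, H`. -/
structure EpisodicMDP (S A : Type*) (H : ℕ) where
  /-- `P h s a` is the law of the next state when action `a` is executed in state `s`. -/
  P : Fin H → S → A → PMF S
  /-- `r h s a` is the reward received when action `a` is executed in state `s`. -/
  r : Fin H → S → A → ℝ
  r_nonneg : ∀ h s a, 0 ≤ r h s a
  r_le_one : ∀ h s a, r h s a ≤ 1

/-- A policy: a map from states to actions for every step. -/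
abbrev Policy (S A : Type*) (H : ℕ) := Fin H → S → A

/-- The record of one episode: the states of all steps, including the terminal one, and the
actions of all steps. -/
abbrev Episode (S A : Type*) (H : ℕ) := (Fin (H + 1) → S) × (Fin H → A)

section Model

variable {S A : Type*} {H : ℕ}

/-- The law of the `n + 1` states visited from step `h` to the end of the episode (`n` steps remain
to be played) when policy `π` is executed and the state at step `h` is `s`. -/
noncomputable def pathLaw (M : EpisodicMDP S A H) (π : Policy S A H) :
    (n h : ℕ) → h + n = H → S → PMF (Fin (n + 1) → S)
  | 0, _, _, s => PMF.pure fun _ => s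
  | n + 1, h, hn, s =>
      (M.P ⟨h, by omega⟩ s (π ⟨h, by omega⟩ s)).bind fun s' =>
        (pathLaw M π n (h + 1) (by omega) s').map fun x => (Fin.cons s x : Fin (n + 2) → S)

/-- The cumulative reward of policy `π` from step `h` to the end of the episode along the visited
states `x`. -/
noncomputable def pathReturn (M : EpisodicMDP S A H) (π : Policy S A H) (n h : ℕ) (hn : h + n = H)
    (x : Fin (n + 1) → S) : ℝ :=
  ∑ i : Fin n, M.r ⟨h + i, by omega⟩ (x i.castSucc) (π ⟨h + i, by omega⟩ (x i.castSucc))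

/-- The value of policy `π` in state `s` of step `h` (when `n` steps remain to be played) under the
entropic risk measure: `(1 / β) log E[exp (β ∑ r) | s_h = s]`. -/
noncomputable def value [Fintype S] (M : EpisodicMDP S A H) (β : ℝ) (π : Policy S A H) (n h : ℕ)
    (hn : h + n = H) (s : S) : ℝ :=
  (1 / β) * Real.log (∑ x : Fin (n + 1) → S,
    (pathLaw M π n h hn s x).toReal * Real.exp (β * pathReturn M π n h hn x))

/-- The optimal value: the supremum of the values of all policies. -/
noncomputable def optValue [Fintype S] (M : EpisodicMDP S A H) (β : ℝ) (n h : ℕ)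
    (hn : h + n = H) (s : S) : ℝ :=
  ⨆ π : Policy S A H, value M β π n h hn s

/-- The law of the record of one episode that starts in `s₁` and is played with policy `π`. -/
noncomputable def episodeLaw (M : EpisodicMDP S A H) (π : Policy S A H) (s₁ : S) :
    PMF (Episode S A H) :=
  (pathLaw M π H 0 (Nat.zero_add H) s₁).map fun x => (x, fun h => π h (x h.castSucc))

/-- A (deterministic) learning rule: the policy of the next episode as a function of the records of
the `k` past episodes. -/
abbrev LearningRule (S A : Type*) (H : ℕ) :=
  (k : ℕ) → (Fin k → Episode S A H) → Policy S A H

/-- The law of the records of the first `k` episodes when every episode starts in `s₁` and the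
policy of each episode is chosen by the rule `L` from the records of the episodes before it. -/
noncomputable def runLaw (M : EpisodicMDP S A H) (L : LearningRule S A H) (s₁ : S) :
    (k : ℕ) → PMF (Fin k → Episode S A H)
  | 0 => PMF.pure Fin.elim0
  | k + 1 => (runLaw M L s₁ k).bind fun past =>
      (episodeLaw M (L k past) s₁).map fun e => (Fin.snoc past e : Fin (k + 1) → Episode S A H)

/-- The policy used in episode `k` of the run `ω`. -/
def policyOf (L : LearningRule S A H) {K : ℕ} (ω : Fin K → Episode S A H) (k : Fin K) :
    Policy S A H :=
  L k fun τ => ω ⟨τ, τ.2.trans k.2⟩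

/-- The regret after `K` episodes: the sum over the episodes of the optimal value at the first step
minus the value of the policy used. -/
noncomputable def regret [Fintype S] (M : EpisodicMDP S A H) (β : ℝ) (L : LearningRule S A H)
    (s₁ : S) {K : ℕ} (ω : Fin K → Episode S A H) : ℝ :=
  ∑ k : Fin K, (optValue M β H 0 (Nat.zero_add H) s₁ -
    value M β (policyOf L ω k) H 0 (Nat.zero_add H) s₁)

end Model

section Algorithm

variable {S A : Type*} [Fintype S] [DecidableEq S] [Fintype A] [DecidableEq A] {H : ℕ}

/-- The number of past episodes in which `(s, a)` was visited at step `h`. -/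
def visits {k : ℕ} (past : Fin k → Episode S A H) (h : Fin H) (s : S) (a : A) : ℕ :=
  (Finset.univ.filter fun τ : Fin k =>
    (past τ).1 h.castSucc = s ∧ (past τ).2 h = a).card

/-- The weight `w_h(s, a)`: the average of `exp (β (r_h(s, a) + V (s_{h+1}^τ)))` over the past
episodes `τ` in which `(s, a)` was visited at step `h`. -/
noncomputable def weight (r : Fin H → S → A → ℝ) (β : ℝ) {k : ℕ}
    (past : Fin k → Episode S A H) (V : S → ℝ) (h : Fin H) (s : S) (a : A) : ℝ :=
  (1 / (visits past h s a : ℝ)) * ∑ τ : Fin k,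
    if (past τ).1 h.castSucc = s ∧ (past τ).2 h = a then
      Real.exp (β * (r h s a + V ((past τ).1 h.succ))) else 0

/-- The doubly decaying bonus `c |exp (β (H - h + 1)) - 1| √(S log (H S A K / δ) / N_h(s, a))`, for
a step counted from `1`; here `h` is counted from `0`. -/
noncomputable def bonus (c β δ : ℝ) (K : ℕ) {k : ℕ}
    (past : Fin k → Episode S A H) (h : Fin H) (s : S) (a : A) : ℝ :=
  c * |Real.exp (β * ((H : ℝ) - (h : ℕ))) - 1| *
    Real.sqrt ((Fintype.card S : ℝ) *
      Real.log ((H : ℝ) * Fintype.card S * Fintype.card A * K / δ) / (visits past h s a : ℝ))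

/-- The optimistic estimate `G_h(s, a)`, computed from the estimate `V` of the value function of the
next step. A pair that was never visited keeps the initial action value, `H - h + 1` for a step
counted from `1`. The rewards enter only at pairs that were visited. -/
noncomputable def estG (r : Fin H → S → A → ℝ) (c β δ : ℝ) (K : ℕ) {k : ℕ}
    (past : Fin k → Episode S A H) (V : S → ℝ) (h : Fin H) (s : S) (a : A) : ℝ :=
  if visits past h s a = 0 then Real.exp (β * ((H : ℝ) - (h : ℕ)))
  else if 0 < β then
    min (weight r β past V h s a + bonus c β δ K past h s a)
      (Real.exp (β * ((H : ℝ) - (h : ℕ))))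
  else
    max (weight r β past V h s a - bonus c β δ K past h s a)
      (Real.exp (β * ((H : ℝ) - (h : ℕ))))

/-- The estimate of the value function at step `h` (when `n` steps remain to be played), by backward
induction from `0` after the last step: `V_h(s) = max_a (1 / β) log G_h(s, a)`. -/
noncomputable def estV [Nonempty A] (r : Fin H → S → A → ℝ) (c β δ : ℝ) (K : ℕ) {k : ℕ}
    (past : Fin k → Episode S A H) : (n h : ℕ) → h + n = H → S → ℝ
  | 0, _, _, _ => 0
  | n + 1, h, hn, s => Finset.univ.sup' Finset.univ_nonempty fun a : A =>
      (1 / β) * Real.log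
        (estG r c β δ K past (estV r c β δ K past n (h + 1) (by omega)) ⟨h, by omega⟩ s a)

/-- The estimate of the action-value function at step `h` at the beginning of an episode:
`Q_h(s, a) = (1 / β) log G_h(s, a)`, with `G_h` computed from the estimate of `V_{h+1}`. -/
noncomputable def estQ [Nonempty A] (r : Fin H → S → A → ℝ) (c β δ : ℝ) (K : ℕ) {k : ℕ}
    (past : Fin k → Episode S A H) (h : Fin H) (s : S) (a : A) : ℝ :=
  (1 / β) * Real.log
    (estG r c β δ K past (estV r c β δ K past (H - (h + 1)) (h + 1) (by omega)) h s a)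

/-- The learning rule `L` is an implementation of the algorithm RSVI2 with bonus constant `c`: in
every episode it plays a policy that is greedy for the estimated action values. Ties are broken in
any way, possibly depending on the past. -/
def IsRSVI2 [Nonempty A] (r : Fin H → S → A → ℝ) (c β δ : ℝ) (K : ℕ)
    (L : LearningRule S A H) : Prop :=
  ∀ (k : ℕ) (past : Fin k → Episode S A H) (h : Fin H) (s : S) (a : A),
    estQ r c β δ K past h s a ≤ estQ r c β δ K past h s (L k past h s)

end Algorithm

end RiskRL

/-! The function `x ↦ exp (β * x) / β` is increasing for either sign of `β`, so exponential values
divided by `β` obey the same inequalities for `β > 0` and `β < 0`. The proof is run on this scale.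

Optimism. The estimate of the next value depends on the data, so concentration must be uniform over
value functions. Exponential supermartingales and a union bound over the `2 ^ S` sign functions
control the empirical kernel in `ℓ¹` (`prob_not_concentrated_le`, `abs_deviation_le`). This costs
the factor `S` under the root of the bonus. On that event `estG` lies above the true Bellman
operator by at most `expGrowth` times `width` (`estG_bounds`), and backward induction makes the
estimated values dominate those of all policies.

Error propagation. The gap between the estimate and the value of the greedy policy is multiplied by
`exp (β * r)` at each step. Since `exp (β * r) * expGrowth β t ≤ expGrowth β (t + 1)`, and the bonus
decays with the step in the same way, the gap is only `expGrowth β H` times the expected sum of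
widths along the episode (`exp_estV_sub_expValue_le`). Taking logarithms costs nothing for `β > 0`
and a factor `exp (|β| * H)` for `β < 0`; both signs give the prefactor `(exp (|β| * H) - 1) / |β|`
(`sub_log_le`).

Summation. A multiplicative martingale bound replaces expected widths by twice the realised ones
plus a term of order `H` times the logarithm (`prob_sum_expectedWidth_le`). The realised widths
behave like `1 / √N`, so they telescope into `√N`, and Cauchy–Schwarz finishes the count
(`sum_episodeWidth_le`). -/

namespace RiskRL

set_option linter.unusedSectionVars false

/-! ### Expectations on finite types, Chernoff bounds and moment generating functions. -/

section Expect

variable {α γ ι : Type*} [Fintype α] [Fintype γ]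

/-- The expectation of a real function under a probability mass function on a finite type. -/
noncomputable def expect (p : PMF α) (f : α → ℝ) : ℝ := ∑ x, (p x).toReal * f x

/-- The probability of an event, as a real number. -/
noncomputable def prob (p : PMF α) (s : Set α) : ℝ := expect p (s.indicator 1)

theorem sum_toReal (p : PMF α) : ∑ x, (p x).toReal = 1 := by
  have h := p.tsum_coe
  rw [tsum_fintype] at h
  rw [← ENNReal.toReal_sum (fun a _ => p.apply_ne_top a), h, ENNReal.toReal_one]

theorem expect_mono {p : PMF α} {f g : α → ℝ} (h : ∀ x, f x ≤ g x) :
    expect p f ≤ expect p g :=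
  Finset.sum_le_sum fun x _ => mul_le_mul_of_nonneg_left (h x) ENNReal.toReal_nonneg

theorem expect_const (p : PMF α) (c : ℝ) : expect p (fun _ => c) = c := by
  simp [expect, ← Finset.sum_mul, sum_toReal]

theorem expect_add (p : PMF α) (f g : α → ℝ) :
    expect p (fun x => f x + g x) = expect p f + expect p g := by
  simp [expect, mul_add, Finset.sum_add_distrib]

theorem expect_sub (p : PMF α) (f g : α → ℝ) :
    expect p (fun x => f x - g x) = expect p f - expect p g := by
  simp [expect, mul_sub, Finset.sum_sub_distrib]

theorem expect_const_mul (p : PMF α) (c : ℝ) (f : α → ℝ) :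
    expect p (fun x => c * f x) = c * expect p f := by
  simp only [expect, Finset.mul_sum]
  exact Finset.sum_congr rfl fun x _ => by ring

theorem expect_sum (p : PMF α) (t : Finset ι) (f : ι → α → ℝ) :
    expect p (fun x => ∑ i ∈ t, f i x) = ∑ i ∈ t, expect p (f i) := by
  simp only [expect, Finset.mul_sum]
  exact Finset.sum_comm

theorem expect_nonneg {p : PMF α} {f : α → ℝ} (h : ∀ x, 0 ≤ f x) : 0 ≤ expect p f :=
  Finset.sum_nonneg fun x _ => mul_nonneg ENNReal.toReal_nonneg (h x)

theorem expect_le_of_le {p : PMF α} {f : α → ℝ} {c : ℝ} (h : ∀ x, f x ≤ c) : expect p f ≤ c :=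
  (expect_mono h).trans_eq (expect_const p c)

theorem le_expect_of_le {p : PMF α} {f : α → ℝ} {c : ℝ} (h : ∀ x, c ≤ f x) : c ≤ expect p f :=
  (expect_const p c).symm.trans_le (expect_mono h)

theorem expect_pure (a : α) (f : α → ℝ) : expect (PMF.pure a) f = f a := by
  classical
  rw [expect, Finset.sum_eq_single a] <;> simp +contextual [PMF.pure_apply]

theorem expect_bind (p : PMF α) (q : α → PMF γ) (f : γ → ℝ) :
    expect (p.bind q) f = expect p fun a => expect (q a) f := by
  have h : ∀ y, ((p.bind q) y).toReal = ∑ x, (p x).toReal * (q x y).toReal := fun y => by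
    rw [PMF.bind_apply, tsum_fintype, ENNReal.toReal_sum]
    · simp
    · exact fun a _ => ENNReal.mul_ne_top (p.apply_ne_top a) ((q a).apply_ne_top y)
  simp only [expect, h, Finset.sum_mul, Finset.mul_sum]
  rw [Finset.sum_comm]
  exact Finset.sum_congr rfl fun x _ => Finset.sum_congr rfl fun y _ => by ring

theorem expect_map (p : PMF α) (g : α → γ) (f : γ → ℝ) :
    expect (p.map g) f = expect p fun a => f (g a) := by
  rw [← PMF.bind_pure_comp, expect_bind]
  simp [expect_pure]

theorem prob_mono {p : PMF α} {s t : Set α} (h : s ⊆ t) : prob p s ≤ prob p t :=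
  expect_mono fun x => Set.indicator_le_indicator_of_subset h (fun _ => zero_le_one) x

theorem prob_union_le (p : PMF α) (s t : Set α) : prob p (s ∪ t) ≤ prob p s + prob p t := by
  rw [prob, prob, prob, ← expect_add]
  refine expect_mono fun x => ?_
  by_cases hs : x ∈ s <;> by_cases ht : x ∈ t <;> simp [hs, ht]

theorem prob_iUnion_le [Fintype ι] (p : PMF α) (s : ι → Set α) (ε : ℝ)
    (h : ∀ i, prob p (s i) ≤ ε) : prob p (⋃ i, s i) ≤ Fintype.card ι * ε := by
  calc prob p (⋃ i, s i) ≤ ∑ i, prob p (s i) := by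
        rw [show ∑ i, prob p (s i) = expect p (fun x => ∑ i, (s i).indicator 1 x) from
          (expect_sum p _ _).symm]
        refine expect_mono fun x => ?_
        have h0 : ∀ i ∈ Finset.univ, (0 : ℝ) ≤ (s i).indicator 1 x :=
          fun i _ => Set.indicator_nonneg (fun _ _ => zero_le_one) x
        by_cases hx : x ∈ ⋃ i, s i
        · obtain ⟨i, hi⟩ := Set.mem_iUnion.1 hx
          rw [Set.indicator_of_mem hx]
          have := Finset.single_le_sum h0 (Finset.mem_univ i)
          rwa [Set.indicator_of_mem hi] at this
        · rw [Set.indicator_of_notMem hx]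
          exact Finset.sum_nonneg h0
    _ ≤ ∑ _i : ι, ε := Finset.sum_le_sum fun i _ => h i
    _ = _ := by simp

/-- The Chernoff bound. -/
theorem prob_le_exp_neg {p : PMF α} {f : α → ℝ} (h : expect p (fun x => Real.exp (f x)) ≤ 1)
    (l : ℝ) {s : Set α} (hs : ∀ x ∈ s, l ≤ f x) : prob p s ≤ Real.exp (-l) := by
  calc prob p s ≤ expect p (fun x => Real.exp (-l) * Real.exp (f x)) := by
        refine expect_mono fun x => ?_
        by_cases hx : x ∈ s
        · rw [Set.indicator_of_mem hx, ← Real.exp_add]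
          exact Real.one_le_exp (by linarith [hs x hx])
        · rw [Set.indicator_of_notMem hx]
          positivity
    _ ≤ Real.exp (-l) := by
        rw [expect_const_mul]
        exact mul_le_of_le_one_right (Real.exp_pos _).le h

/-- Bridge from real-valued probabilities of a failure event `t` to the outer measure of the good
event. -/
theorem ofReal_one_sub_le_toOuterMeasure {p : PMF α} {s t : Set α} {δ : ℝ} (h : prob p t ≤ δ)
    (hst : ∀ x, x ∉ t → x ∈ s) : ENNReal.ofReal (1 - δ) ≤ p.toOuterMeasure s := by
  classical
  have h1 : p.toOuterMeasure s = ENNReal.ofReal (prob p s) := by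
    rw [PMF.toOuterMeasure_apply, tsum_fintype, prob, expect, ENNReal.ofReal_sum_of_nonneg]
    · refine Finset.sum_congr rfl fun x _ => ?_
      by_cases hx : x ∈ s <;> simp [hx, ENNReal.ofReal_toReal (p.apply_ne_top x)]
    · intro x _
      by_cases hx : x ∈ s <;> simp [hx]
  rw [h1]
  refine ENNReal.ofReal_le_ofReal ?_
  have h2 : prob p Set.univ ≤ prob p t + prob p s :=
    (prob_mono fun x _ => by by_cases hx : x ∈ t <;> simp [hx, hst]).trans (prob_union_le p t s)
  have h3 : prob p Set.univ = 1 := by simp only [prob, Set.indicator_univ]; exact expect_const p 1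
  linarith

/-- Hoeffding's lemma for a function with values in `[-1, 1]`. -/
theorem expect_exp_le (p : PMF α) {f : α → ℝ} (hf : ∀ x, f x ∈ Set.Icc (-1) 1) (t : ℝ) :
    expect p (fun x => Real.exp (t * (f x - expect p f))) ≤ Real.exp (t ^ 2 / 2) := by
  let _ : MeasurableSpace α := ⊤
  have hint : ∀ g : α → ℝ, ∫ x, g x ∂p.toMeasure = expect p g := fun g => by
    rw [PMF.integral_eq_sum]; rfl
  have h := (ProbabilityTheory.hasSubgaussianMGF_of_mem_Icc (μ := p.toMeasure) (X := f)
    (Measurable.of_discrete.aemeasurable) (Filter.Eventually.of_forall hf)).mgf_le t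
  rw [ProbabilityTheory.mgf, hint, hint] at h
  refine h.trans_eq ?_
  congr 1
  norm_num

/-- A multiplicative lower-tail bound on the moment generating function. -/
theorem expect_exp_half_sub_le_one (p : PMF α) {f : α → ℝ} (h0 : ∀ x, 0 ≤ f x)
    (h1 : ∀ x, f x ≤ 1) : expect p (fun x => Real.exp (expect p f / 2 - f x)) ≤ 1 := by
  -- With `1 + y + y² / 2 ≤ exp y` it suffices that `(1 - y / 2) (1 + y + y² / 2) = 1 + y / 2 - y³ /
  -- 4` is at least `1` on `[0, 1]`.
  have key : ∀ y : ℝ, 0 ≤ y → y ≤ 1 → Real.exp (-y) ≤ 1 - 1 / 2 * y := fun y hy hy1 => by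
    have h2 := Real.quadratic_le_exp_of_nonneg hy
    rw [Real.exp_neg, inv_le_comm₀ (Real.exp_pos y) (by linarith), inv_le_iff_one_le_mul₀ (by linarith)]
    nlinarith [mul_nonneg hy hy, mul_nonneg (mul_nonneg hy hy) (sub_nonneg.2 hy1)]
  have h3 : expect p (fun x => Real.exp (-f x)) ≤ 1 - 1 / 2 * expect p f := by
    refine (expect_mono fun x => key (f x) (h0 x) (h1 x)).trans_eq ?_
    rw [expect_sub, expect_const, expect_const_mul]
  simp only [sub_eq_add_neg (expect p f / 2), Real.exp_add]
  rw [expect_const_mul]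
  have h4 : 1 - 1 / 2 * expect p f ≤ Real.exp (-(expect p f / 2)) := by
    linarith [Real.add_one_le_exp (-(expect p f / 2))]
  calc _ ≤ Real.exp (expect p f / 2) * Real.exp (-(expect p f / 2)) :=
        mul_le_mul_of_nonneg_left (h3.trans h4) (Real.exp_pos _).le
    _ = 1 := by rw [← Real.exp_add, add_neg_cancel, Real.exp_zero]

end Expect

/-! ### Path laws, the exponential Bellman equation and supermartingales along a run. -/

section Model

variable {S A : Type*} [Fintype S] {H : ℕ}

theorem expect_pathLaw_succ (M : EpisodicMDP S A H) (π : Policy S A H) (n h : ℕ)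
    (hn : h + (n + 1) = H) (s : S) (f : (Fin (n + 2) → S) → ℝ) :
    expect (pathLaw M π (n + 1) h hn s) f =
      expect (M.P ⟨h, by omega⟩ s (π ⟨h, by omega⟩ s)) fun s' =>
        expect (pathLaw M π n (h + 1) (by omega) s') fun x =>
          f (Fin.cons s x : Fin (n + 2) → S) := by
  rw [pathLaw, expect_bind]
  simp only [expect_map]

theorem expect_pathLaw_head (M : EpisodicMDP S A H) (π : Policy S A H) (n h : ℕ)
    (hn : h + n = H) (s : S) (f : S → ℝ) :
    expect (pathLaw M π n h hn s) (fun x => f (x 0)) = f s := by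
  cases n with
  | zero => rw [pathLaw, expect_pure]
  | succ n =>
    rw [expect_pathLaw_succ]
    simp [expect_const]

/-- A bound on the conditional expectation of a function of one transition, whatever the state
before the transition, bounds its expectation along the path. -/
theorem expect_pathLaw_transition_le (M : EpisodicMDP S A H) (π : Policy S A H) (n h : ℕ)
    (hn : h + n = H) (s : S) (i : Fin n) (φ : S → S → ℝ) (c : ℝ)
    (hφ : ∀ t, expect (M.P ⟨h + i, by omega⟩ t (π ⟨h + i, by omega⟩ t)) (φ t) ≤ c) :
    expect (pathLaw M π n h hn s) (fun x => φ (x i.castSucc) (x i.succ)) ≤ c := by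
  induction n generalizing h s with
  | zero => exact i.elim0
  | succ n ih =>
    rw [expect_pathLaw_succ]
    cases i using Fin.cases with
    | zero =>
      simp only [Fin.castSucc_zero, Fin.cons_zero, Fin.cons_succ, expect_pathLaw_head]
      exact hφ s
    | succ j =>
      refine expect_le_of_le fun s' => ?_
      simp only [Fin.castSucc_succ, Fin.cons_succ]
      refine ih (h + 1) (by omega) s' j fun t => ?_
      have e : h + 1 + (j : ℕ) = h + (j.succ : ℕ) := by simp; omega
      simp only [e]
      exact hφ t

/-- The expectation of the sum of `f` over the steps of an episode from step `h` on. -/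
theorem expect_pathLaw_sum_succ (M : EpisodicMDP S A H) (π : Policy S A H) (f : Fin H → S → ℝ)
    (n h : ℕ) (hn : h + (n + 1) = H) (s : S) :
    expect (pathLaw M π (n + 1) h hn s)
        (fun x => ∑ i : Fin (n + 1), f ⟨h + i, by omega⟩ (x i.castSucc)) =
      f ⟨h, by omega⟩ s + expect (M.P ⟨h, by omega⟩ s (π ⟨h, by omega⟩ s)) fun s' =>
        expect (pathLaw M π n (h + 1) (by omega) s')
          fun x => ∑ i : Fin n, f ⟨h + 1 + i, by omega⟩ (x i.castSucc) := by
  rw [expect_pathLaw_succ]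
  have e : ∀ i : Fin n, h + (i.succ : ℕ) = h + 1 + i := fun i => by simp; omega
  simp only [Fin.sum_univ_succ, Fin.castSucc_zero, Fin.cons_zero, Fin.castSucc_succ, Fin.cons_succ,
    expect_add, expect_const, e]
  rfl

/-- The exponential value function `E[exp (β ∑ r) | s_h = s]`. -/
noncomputable def expValue (M : EpisodicMDP S A H) (β : ℝ) (π : Policy S A H) (n h : ℕ)
    (hn : h + n = H) (s : S) : ℝ :=
  expect (pathLaw M π n h hn s) fun x => Real.exp (β * pathReturn M π n h hn x)

theorem value_eq (M : EpisodicMDP S A H) (β : ℝ) (π : Policy S A H) (n h : ℕ)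
    (hn : h + n = H) (s : S) :
    value M β π n h hn s = (1 / β) * Real.log (expValue M β π n h hn s) := rfl

theorem expValue_zero (M : EpisodicMDP S A H) (β : ℝ) (π : Policy S A H) (h : ℕ)
    (hn : h + 0 = H) (s : S) : expValue M β π 0 h hn s = 1 := by
  simp [expValue, pathReturn, expect_const]

/-- The exponential Bellman equation. -/
theorem expValue_succ (M : EpisodicMDP S A H) (β : ℝ) (π : Policy S A H) (n h : ℕ)
    (hn : h + (n + 1) = H) (s : S) :
    expValue M β π (n + 1) h hn s =
      expect (M.P ⟨h, by omega⟩ s (π ⟨h, by omega⟩ s)) fun s' =>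
        Real.exp (β * M.r ⟨h, by omega⟩ s (π ⟨h, by omega⟩ s)) *
          expValue M β π n (h + 1) (by omega) s' := by
  rw [expValue, expect_pathLaw_succ]
  simp only [expValue, ← expect_const_mul]
  refine congrArg _ (funext fun s' => congrArg _ (funext fun x => ?_))
  rw [← Real.exp_add, ← mul_add]
  congr 2
  have e : ∀ i : Fin n, h + (i.succ : ℕ) = h + 1 + i := fun i => by simp; omega
  simp only [pathReturn, Fin.sum_univ_succ, Fin.castSucc_zero, Fin.cons_zero, Fin.castSucc_succ,
    Fin.cons_succ, e]
  rfl

theorem pathReturn_mem_Icc (M : EpisodicMDP S A H) (π : Policy S A H) (n h : ℕ)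
    (hn : h + n = H) (x : Fin (n + 1) → S) : pathReturn M π n h hn x ∈ Set.Icc (0 : ℝ) n := by
  refine ⟨Finset.sum_nonneg fun i _ => M.r_nonneg _ _ _, ?_⟩
  refine (Finset.sum_le_sum fun i _ => M.r_le_one _ _ _).trans ?_
  simp

theorem expValue_pos (M : EpisodicMDP S A H) (β : ℝ) (π : Policy S A H) (n h : ℕ)
    (hn : h + n = H) (s : S) : 0 < expValue M β π n h hn s := by
  refine (Real.exp_pos (-(|β| * n))).trans_le (le_expect_of_le fun x => ?_)
  have h1 := pathReturn_mem_Icc M π n h hn x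
  refine Real.exp_le_exp.2 (neg_le_of_abs_le ?_)
  rw [abs_mul, abs_of_nonneg h1.1]
  exact mul_le_mul_of_nonneg_left h1.2 (abs_nonneg β)

theorem expect_episodeLaw (M : EpisodicMDP S A H) (π : Policy S A H) (s₁ : S) [Fintype A]
    (f : Episode S A H → ℝ) :
    expect (episodeLaw M π s₁) f = expect (pathLaw M π H 0 (Nat.zero_add H) s₁)
      fun x => f (x, fun h => π h (x h.castSucc)) :=
  expect_map _ _ _

theorem expect_runLaw_succ [Fintype A] (M : EpisodicMDP S A H) (L : LearningRule S A H) (s₁ : S)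
    (k : ℕ) (f : (Fin (k + 1) → Episode S A H) → ℝ) :
    expect (runLaw M L s₁ (k + 1)) f = expect (runLaw M L s₁ k) fun past =>
      expect (episodeLaw M (L k past) s₁) fun e =>
        f (Fin.snoc past e : Fin (k + 1) → Episode S A H) := by
  rw [runLaw, expect_bind]
  simp only [expect_map]

/-- The first `k` episodes of a run of `K` episodes are a run of `k` episodes. -/
theorem expect_runLaw_castLE [Fintype A] (M : EpisodicMDP S A H) (L : LearningRule S A H) (s₁ : S)
    {k K : ℕ} (hk : k ≤ K) (f : (Fin k → Episode S A H) → ℝ) :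
    expect (runLaw M L s₁ K) (fun ω => f fun τ => ω (Fin.castLE hk τ)) =
      expect (runLaw M L s₁ k) f := by
  induction K, hk using Nat.le_induction with
  | base => rfl
  | succ K hK ih =>
    rw [expect_runLaw_succ, ← ih]
    refine congrArg _ (funext fun past => ?_)
    rw [← expect_const (episodeLaw M (L K past) s₁) (f fun τ => past (Fin.castLE hK τ))]
    refine congrArg _ (funext fun e => congrArg f (funext fun τ => ?_))
    have : Fin.castLE (Nat.le_succ_of_le hK) τ = (Fin.castLE hK τ).castSucc := rfl
    rw [this, Fin.snoc_castSucc]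

/-- A process that starts below `1` and whose conditional expectations do not increase has
expectation at most `1`. -/
theorem expect_runLaw_le_one [Fintype A] (M : EpisodicMDP S A H) (L : LearningRule S A H) (s₁ : S)
    (Φ : (k : ℕ) → (Fin k → Episode S A H) → ℝ) (h0 : ∀ x, Φ 0 x ≤ 1)
    (hΦ : ∀ k past, expect (episodeLaw M (L k past) s₁)
      (fun e => Φ (k + 1) (Fin.snoc past e : Fin (k + 1) → Episode S A H)) ≤ Φ k past) (k : ℕ) :
    expect (runLaw M L s₁ k) (Φ k) ≤ 1 := by
  induction k with
  | zero => exact expect_le_of_le h0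
  | succ k ih =>
    rw [expect_runLaw_succ]
    exact (expect_mono (hΦ k)).trans ih

end Model

/-! ### Concentration of the empirical transition kernels. -/

section Concentration

variable {S A : Type*} [Fintype S] [DecidableEq S] [Fintype A] [DecidableEq A] {H : ℕ}

/-- The records of the episodes before episode `k`. -/
def pastOf {K : ℕ} (ω : Fin K → Episode S A H) (k : Fin K) : Fin k → Episode S A H :=
  fun τ => ω ⟨τ, τ.2.trans k.2⟩

theorem pastOf_snoc_castSucc {K : ℕ} (ω : Fin K → Episode S A H) (e : Episode S A H)
    (k : Fin K) :
    pastOf (Fin.snoc ω e : Fin (K + 1) → Episode S A H) k.castSucc = pastOf ω k := by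
  funext τ
  exact Fin.snoc_castSucc (α := fun _ => Episode S A H) e ω ⟨τ, τ.2.trans k.2⟩

theorem pastOf_snoc_last {K : ℕ} (ω : Fin K → Episode S A H) (e : Episode S A H) :
    pastOf (Fin.snoc ω e : Fin (K + 1) → Episode S A H) (Fin.last K) = ω := by
  funext τ
  exact Fin.snoc_castSucc (α := fun _ => Episode S A H) e ω τ

/-- The sum of the conditional expectations of adapted `[0, 1]`-valued variables is controlled by
the sum of the variables. -/
theorem prob_sum_expect_le (M : EpisodicMDP S A H) (L : LearningRule S A H) (s₁ : S)
    (Y : (k : ℕ) → (Fin k → Episode S A H) → Episode S A H → ℝ) (h0 : ∀ k past e, 0 ≤ Y k past e)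
    (h1 : ∀ k past e, Y k past e ≤ 1) (K : ℕ) (l : ℝ) :
    prob (runLaw M L s₁ K) {ω | l ≤ ∑ k : Fin K,
      (expect (episodeLaw M (L k (pastOf ω k)) s₁) (Y k (pastOf ω k)) / 2 -
        Y k (pastOf ω k) (ω k))} ≤ Real.exp (-l) := by
  refine prob_le_exp_neg (f := fun ω => ∑ k : Fin K,
      (expect (episodeLaw M (L k (pastOf ω k)) s₁) (Y k (pastOf ω k)) / 2 -
        Y k (pastOf ω k) (ω k))) ?_ l fun ω hω => hω
  refine expect_runLaw_le_one M L s₁ (fun K ω => Real.exp (∑ k : Fin K,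
      (expect (episodeLaw M (L k (pastOf ω k)) s₁) (Y k (pastOf ω k)) / 2 -
        Y k (pastOf ω k) (ω k)))) (by simp) (fun k past => ?_) K
  simp only [Fin.sum_univ_castSucc, Fin.snoc_castSucc, Fin.snoc_last, pastOf_snoc_castSucc,
    Real.exp_add, Fin.val_castSucc]
  rw [expect_const_mul]
  refine mul_le_of_le_one_right (Real.exp_pos _).le ?_
  simp only [pastOf_snoc_last]
  exact expect_exp_half_sub_le_one _ (h0 k past) (h1 k past)

theorem visits_snoc {k : ℕ} (past : Fin k → Episode S A H) (e : Episode S A H) (h : Fin H) (s : S)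
    (a : A) : visits (Fin.snoc past e : Fin (k + 1) → Episode S A H) h s a =
      visits past h s a + if e.1 h.castSucc = s ∧ e.2 h = a then 1 else 0 := by
  simp only [visits, Finset.card_filter, Fin.sum_univ_castSucc, Fin.snoc_castSucc, Fin.snoc_last]

/-- The sum over the past visits of `(s, a)` at step `h` of the difference between the value of `g`
at the next state and its conditional expectation. -/
noncomputable def deviation (M : EpisodicMDP S A H) {k : ℕ} (past : Fin k → Episode S A H)
    (h : Fin H) (s : S) (a : A) (g : S → ℝ) : ℝ :=
  ∑ τ : Fin k, if (past τ).1 h.castSucc = s ∧ (past τ).2 h = a then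
    g ((past τ).1 h.succ) - expect (M.P h s a) g else 0

theorem deviation_snoc (M : EpisodicMDP S A H) {k : ℕ} (past : Fin k → Episode S A H)
    (e : Episode S A H) (h : Fin H) (s : S) (a : A) (g : S → ℝ) :
    deviation M (Fin.snoc past e : Fin (k + 1) → Episode S A H) h s a g =
      deviation M past h s a g + if e.1 h.castSucc = s ∧ e.2 h = a then
        g (e.1 h.succ) - expect (M.P h s a) g else 0 := by
  simp only [deviation, Fin.sum_univ_castSucc, Fin.snoc_castSucc, Fin.snoc_last]

/-- An exponential supermartingale: Hoeffding's lemma bounds the factor contributed by a visit by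
`exp (t ^ 2 / 2)`, which the compensator cancels, and an episode without a visit contributes `1`.
The compensator carries the random number of visits. -/
theorem expect_exp_deviation_le_one (M : EpisodicMDP S A H) (L : LearningRule S A H) (s₁ : S)
    (h : Fin H) (s : S) (a : A) {g : S → ℝ} (hg : ∀ x, g x ∈ Set.Icc (-1) 1) (t : ℝ) (k : ℕ) :
    expect (runLaw M L s₁ k) (fun past => Real.exp
      (t * deviation M past h s a g - t ^ 2 / 2 * visits past h s a)) ≤ 1 := by
  refine expect_runLaw_le_one M L s₁ (fun k past => Real.exp
      (t * deviation M past h s a g - t ^ 2 / 2 * visits past h s a)) (fun x => ?_)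
      (fun k past => ?_) k
  · simp [deviation, visits]
  · simp only [deviation_snoc, visits_snoc]
    have e : ∀ e : Episode S A H, Real.exp (t * (deviation M past h s a g +
        if e.1 h.castSucc = s ∧ e.2 h = a then g (e.1 h.succ) - expect (M.P h s a) g else 0) -
        t ^ 2 / 2 * (visits past h s a + if e.1 h.castSucc = s ∧ e.2 h = a then 1 else 0 : ℕ)) =
        Real.exp (t * deviation M past h s a g - t ^ 2 / 2 * visits past h s a) *
          if e.1 h.castSucc = s ∧ e.2 h = a then
            Real.exp (-(t ^ 2 / 2)) * Real.exp (t * (g (e.1 h.succ) - expect (M.P h s a) g))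
          else 1 := by
      intro e
      split_ifs
      · rw [← Real.exp_add, ← Real.exp_add]
        congr 1
        push_cast
        ring
      · simp
    simp only [e]
    rw [expect_const_mul]
    refine mul_le_of_le_one_right (Real.exp_pos _).le ?_
    rw [expect_episodeLaw]
    -- Whether `(s, a)` is visited is decided by the state before the transition, so one conditional
    -- expectation suffices.
    refine expect_pathLaw_transition_le M (L k past) H 0 (Nat.zero_add H) s₁ h
      (fun x y => if x = s ∧ L k past h x = a then
        Real.exp (-(t ^ 2 / 2)) * Real.exp (t * (g y - expect (M.P h s a) g)) else 1) 1
      fun x => ?_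
    have e0 : (⟨0 + (h : ℕ), by omega⟩ : Fin H) = h := Fin.ext (Nat.zero_add _)
    rw [e0]
    by_cases hx : x = s ∧ L k past h x = a
    · simp only [if_pos hx]
      rw [expect_const_mul, hx.2, hx.1]
      calc _ ≤ Real.exp (-(t ^ 2 / 2)) * Real.exp (t ^ 2 / 2) :=
            mul_le_mul_of_nonneg_left (expect_exp_le _ hg t) (Real.exp_pos _).le
        _ = 1 := by rw [← Real.exp_add, neg_add_cancel, Real.exp_zero]
    · simp only [hx, if_false, expect_const, le_refl]

/-- A deviation inequality for a fixed number of visits. -/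
theorem prob_deviation_le (M : EpisodicMDP S A H) (L : LearningRule S A H) (s₁ : S)
    (h : Fin H) (s : S) (a : A) {g : S → ℝ} (hg : ∀ x, g x ∈ Set.Icc (-1) 1) (k n : ℕ)
    (hn : 0 < n) {l : ℝ} (hl : 0 ≤ l) :
    prob (runLaw M L s₁ k) {past | visits past h s a = n ∧
      Real.sqrt (2 * l * n) ≤ deviation M past h s a g} ≤ Real.exp (-l) := by
  have hn' : (0 : ℝ) < n := Nat.cast_pos.2 hn
  -- With `D = √(2 l n)`, the parameter `t = D / n` maximises `t D - t² n / 2`, and the maximum is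
  -- `l`.
  refine prob_le_exp_neg
    (expect_exp_deviation_le_one M L s₁ h s a hg (Real.sqrt (2 * l * n) / n) k) l ?_
  rintro past ⟨h1, h2⟩
  have h3 : Real.sqrt (2 * l * n) ^ 2 = 2 * l * n := Real.sq_sqrt (by positivity)
  rw [h1]
  calc l = Real.sqrt (2 * l * n) / n * Real.sqrt (2 * l * n) -
        (Real.sqrt (2 * l * n) / n) ^ 2 / 2 * n := by
        have : (Real.sqrt (2 * l * n) / n) * Real.sqrt (2 * l * n) = 2 * l := by
          rw [div_mul_eq_mul_div, ← sq, h3]; field_simp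
        rw [this, div_pow, h3]; field_simp; ring
    _ ≤ _ := by gcongr

/-- The function with values `1` and `-1` given by a choice of signs. -/
def signFun (σ : S → Bool) (x : S) : ℝ := if σ x then 1 else -1

theorem signFun_mem_Icc (σ : S → Bool) (x : S) : signFun σ x ∈ Set.Icc (-1 : ℝ) 1 := by
  unfold signFun
  split_ifs <;> norm_num

theorem deviation_eq_sum (M : EpisodicMDP S A H) {k : ℕ} (past : Fin k → Episode S A H)
    (h : Fin H) (s : S) (a : A) (g : S → ℝ) :
    deviation M past h s a g = ∑ y, g y * deviation M past h s a (Pi.single y 1) := by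
  simp only [deviation, Finset.mul_sum]
  rw [Finset.sum_comm]
  refine Finset.sum_congr rfl fun τ _ => ?_
  split_ifs
  · simp only [mul_sub, Finset.sum_sub_distrib, expect]
    congr 1
    · simp [Pi.single_apply]
    · simp [Pi.single_apply, mul_comm]
  · simp

/-- A deviation bound for all sign functions is a bound in total variation. -/
theorem abs_deviation_le (M : EpisodicMDP S A H) {k : ℕ} (past : Fin k → Episode S A H)
    (h : Fin H) (s : S) (a : A) {b W : ℝ} (hW : 0 ≤ W)
    (hb : ∀ σ : S → Bool, deviation M past h s a (signFun σ) ≤ b) {g : S → ℝ}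
    (hg : ∀ x, |g x| ≤ W) : |deviation M past h s a g| ≤ W * b := by
  set d : S → ℝ := fun y => deviation M past h s a (Pi.single y 1) with hd
  have h1 : ∑ y, |d y| ≤ b := by
    -- The signs of `d` realise its `ℓ¹` norm.
    refine le_trans (le_of_eq ?_) (hb fun y => decide (0 ≤ d y))
    rw [deviation_eq_sum]
    refine Finset.sum_congr rfl fun y _ => ?_
    change |d y| = (if decide (0 ≤ d y) then 1 else -1) * d y
    by_cases hy : 0 ≤ d y
    · simp [hy, abs_of_nonneg hy]
    · simp [hy, abs_of_neg (not_le.1 hy)]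
  rw [deviation_eq_sum]
  calc |∑ y, g y * d y| ≤ ∑ y, |g y * d y| := Finset.abs_sum_le_sum_abs _ _
    _ ≤ ∑ y, W * |d y| := Finset.sum_le_sum fun y _ => by
        rw [abs_mul]; exact mul_le_mul_of_nonneg_right (hg y) (abs_nonneg _)
    _ ≤ W * b := by rw [← Finset.mul_sum]; exact mul_le_mul_of_nonneg_left h1 hW

/-- The event that the empirical transition frequencies before an episode are close to the
transition kernels. -/
def Concentrated (M : EpisodicMDP S A H) (l : ℝ) {k : ℕ} (past : Fin k → Episode S A H) : Prop :=
  ∀ (h : Fin H) (s : S) (a : A) (σ : S → Bool),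
    deviation M past h s a (signFun σ) ≤ Real.sqrt (2 * l * visits past h s a)

theorem visits_le {k : ℕ} (past : Fin k → Episode S A H) (h : Fin H) (s : S) (a : A) :
    visits past h s a ≤ k := by
  exact (Finset.card_filter_le _ _).trans_eq (by simp)

theorem deviation_eq_zero (M : EpisodicMDP S A H) {k : ℕ} {past : Fin k → Episode S A H}
    {h : Fin H} {s : S} {a : A} (hv : visits past h s a = 0) (g : S → ℝ) :
    deviation M past h s a g = 0 := by
  rw [visits, Finset.card_eq_zero, Finset.filter_eq_empty_iff] at hv
  exact Finset.sum_eq_zero fun τ _ => if_neg (hv (Finset.mem_univ τ))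

/-- Union bound over the episode, the value of the random visit count, the step, the pair and the
signs. Counts `1, …, K` are coded by `Fin K` with a shift by one; a pair without visits has
deviation `0` and cannot fail. -/
theorem prob_not_concentrated_le (M : EpisodicMDP S A H) (L : LearningRule S A H) (s₁ : S)
    (K : ℕ) {l : ℝ} (hl : 0 ≤ l) :
    prob (runLaw M L s₁ K) {ω | ∃ k : Fin K, ¬ Concentrated M l (pastOf ω k)} ≤
      (K * (K * (H * (Fintype.card S * (Fintype.card A * 2 ^ Fintype.card S)))) : ℕ) *
        Real.exp (-l) := by
  have hcard : Fintype.card (Fin K × Fin K × Fin H × S × A × (S → Bool)) =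
      K * (K * (H * (Fintype.card S * (Fintype.card A * 2 ^ Fintype.card S)))) := by simp
  rw [← hcard]
  refine le_trans (prob_mono ?_) (prob_iUnion_le _
    (fun i : Fin K × Fin K × Fin H × S × A × (S → Bool) => {ω : Fin K → Episode S A H |
      visits (pastOf ω i.1) i.2.2.1 i.2.2.2.1 i.2.2.2.2.1 = i.2.1 + 1 ∧
        Real.sqrt (2 * l * (i.2.1 + 1 : ℕ)) ≤ deviation M (pastOf ω i.1) i.2.2.1 i.2.2.2.1
          i.2.2.2.2.1 (signFun i.2.2.2.2.2)}) (Real.exp (-l)) ?_)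
  · rintro ω ⟨k, hk⟩
    simp only [Concentrated, not_forall, not_le] at hk
    obtain ⟨h, s, a, σ, hd⟩ := hk
    have hv : visits (pastOf ω k) h s a ≠ 0 := fun h0 => by
      rw [deviation_eq_zero M h0] at hd
      exact absurd hd (not_lt.2 (Real.sqrt_nonneg _))
    have hv2 : visits (pastOf ω k) h s a - 1 < K := by
      have := visits_le (pastOf ω k) h s a
      omega
    have hv3 : visits (pastOf ω k) h s a - 1 + 1 = visits (pastOf ω k) h s a := by omega
    refine Set.mem_iUnion.2 ⟨(k, ⟨_, hv2⟩, h, s, a, σ), ?_⟩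
    simp only [Set.mem_ofPred_eq, hv3, true_and]
    exact hd.le
  · rintro ⟨k, n, h, s, a, σ⟩
    have h1 := prob_deviation_le M L s₁ h s a (signFun_mem_Icc σ) k (n + 1) n.1.succ_pos hl
    -- The event depends on the first `k` episodes only.
    rw [prob, ← expect_runLaw_castLE M L s₁ k.2.le] at h1
    exact h1

end Concentration

/-! ### The utility `exp (β * x) / β`, monotone for both signs of `β`. -/

section Scaling

theorem exp_div_le_exp_div {β x y : ℝ} (h : x ≤ y) : Real.exp (β * x) / β ≤ Real.exp (β * y) / β := by
  rcases lt_trichotomy β 0 with hβ | rfl | hβ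
  · exact (div_le_div_right_of_neg hβ).2 (Real.exp_le_exp.2 (mul_le_mul_of_nonpos_left h hβ.le))
  · simp
  · exact (div_le_div_iff_of_pos_right hβ).2 (Real.exp_le_exp.2 (mul_le_mul_of_nonneg_left h hβ.le))

theorem exp_mul_inv_mul_log {β x : ℝ} (hβ : β ≠ 0) (hx : 0 < x) :
    Real.exp (β * ((1 / β) * Real.log x)) = x := by
  rw [← mul_assoc, mul_one_div_cancel hβ, one_mul, Real.exp_log hx]

theorem le_of_exp_div_le_exp_div {β x y : ℝ} (hβ : β ≠ 0)
    (h : Real.exp (β * x) / β ≤ Real.exp (β * y) / β) : x ≤ y := by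
  by_contra! hxy
  refine absurd (le_antisymm h (exp_div_le_exp_div hxy.le)) fun he => ?_
  rw [div_left_inj' hβ, Real.exp_eq_exp, mul_right_inj' hβ] at he
  exact hxy.ne' he

theorem expect_div_le_div {α : Type*} [Fintype α] {p : PMF α} {f g : α → ℝ} {β : ℝ}
    (h : ∀ x, f x / β ≤ g x / β) : expect p f / β ≤ expect p g / β := by
  simp only [div_eq_inv_mul] at h ⊢
  rw [← expect_const_mul, ← expect_const_mul]
  exact expect_mono h

/-- The growth `(exp (β t) - 1) / β` of the exponential utility over a return of size `t`. -/
noncomputable def expGrowth (β t : ℝ) : ℝ := (Real.exp (β * t) - 1) / β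

theorem expGrowth_nonneg (β : ℝ) {t : ℝ} (ht : 0 ≤ t) : 0 ≤ expGrowth β t := by
  have := exp_div_le_exp_div (β := β) ht
  rw [mul_zero, Real.exp_zero] at this
  rw [expGrowth, sub_div]
  linarith

theorem abs_exp_sub_one (β : ℝ) {t : ℝ} (ht : 0 ≤ t) :
    |Real.exp (β * t) - 1| = |β| * expGrowth β t := by
  rcases eq_or_ne β 0 with rfl | hβ
  · simp
  · rw [← abs_of_nonneg (expGrowth_nonneg β ht), ← abs_mul, expGrowth, mul_div_cancel₀ _ hβ]

/-- The left side is the utility increment from `r` to `t + r`, and `[r, t + r]` lies inside `[0, t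
+ 1]`. This prevents errors from compounding over the steps. -/
theorem exp_mul_expGrowth_le (β : ℝ) {r t : ℝ} (h0 : 0 ≤ r) (h1 : r ≤ 1) :
    Real.exp (β * r) * expGrowth β t ≤ expGrowth β (t + 1) := by
  have h2 := exp_div_le_exp_div (β := β) h0
  have h3 := exp_div_le_exp_div (β := β) (add_le_add_right h1 t)
  rw [mul_zero, Real.exp_zero] at h2
  have e : Real.exp (β * r) * expGrowth β t =
      Real.exp (β * (t + r)) / β - Real.exp (β * r) / β := by
    rw [expGrowth, mul_add, Real.exp_add]; ring
  rw [e, expGrowth, sub_div]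
  linarith

end Scaling

/-! ### One-step accuracy of the optimistic estimate. -/

section Estimates

variable {S A : Type*} [Fintype S] [DecidableEq S] [Fintype A] [DecidableEq A] {H : ℕ}

/-- The logarithmic factor `log (H S A K / δ)`. -/
noncomputable def logFactor (S A : Type*) [Fintype S] [Fintype A] (H K : ℕ) (δ : ℝ) : ℝ :=
  Real.log ((H : ℝ) * Fintype.card S * Fintype.card A * K / δ)

/-- The relative width of the confidence interval at `(s, a)`. -/
noncomputable def width (l : ℝ) {k : ℕ} (past : Fin k → Episode S A H) (h : Fin H) (s : S) (a : A) :
    ℝ :=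
  if visits past h s a = 0 then 1 else min 1 (2 * Real.sqrt (2 * l / visits past h s a))

theorem width_nonneg (l : ℝ) {k : ℕ} (past : Fin k → Episode S A H) (h : Fin H) (s : S) (a : A) :
    0 ≤ width l past h s a := by
  unfold width
  split_ifs
  · exact zero_le_one
  · positivity

theorem width_le_one (l : ℝ) {k : ℕ} (past : Fin k → Episode S A H) (h : Fin H) (s : S) (a : A) :
    width l past h s a ≤ 1 := by
  unfold width
  split_ifs
  · exact le_rfl
  · exact min_le_left _ _

/-- The exponential Bellman operator with the true transition kernels. -/
noncomputable def expBellman (M : EpisodicMDP S A H) (β : ℝ) (V : S → ℝ) (h : Fin H) (s : S)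
    (a : A) : ℝ :=
  expect (M.P h s a) fun x => Real.exp (β * (M.r h s a + V x))

theorem expBellman_div_mem_Icc (M : EpisodicMDP S A H) (β : ℝ) {V : S → ℝ} {t : ℝ}
    (hV : ∀ x, V x ∈ Set.Icc 0 t) (h : Fin H) (s : S) (a : A) :
    expBellman M β V h s a / β ∈ Set.Icc (1 / β) (Real.exp (β * (t + 1)) / β) := by
  constructor
  · have := expect_div_le_div (p := M.P h s a) (β := β) fun x => exp_div_le_exp_div (β := β)
      (add_nonneg (M.r_nonneg h s a) (hV x).1)
    simpa [expect_const, expBellman] using this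
  · have := expect_div_le_div (p := M.P h s a) (β := β) fun x => exp_div_le_exp_div (β := β)
      (show M.r h s a + V x ≤ t + 1 by linarith [M.r_le_one h s a, (hV x).2])
    rwa [expect_const] at this

theorem sum_ite_visit {k : ℕ} (past : Fin k → Episode S A H) (h : Fin H) (s : S) (a : A) (c : ℝ) :
    (∑ τ : Fin k, if (past τ).1 h.castSucc = s ∧ (past τ).2 h = a then c else 0) =
      visits past h s a * c := by
  rw [← Finset.sum_filter, Finset.sum_const, nsmul_eq_mul]
  rfl

theorem one_div_le_weight_div (M : EpisodicMDP S A H) (β : ℝ) {k : ℕ}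
    (past : Fin k → Episode S A H) {V : S → ℝ} (hV : ∀ x, 0 ≤ V x) (h : Fin H) (s : S) (a : A)
    (hN : visits past h s a ≠ 0) : 1 / β ≤ weight M.r β past V h s a / β := by
  have hN' : (visits past h s a : ℝ) ≠ 0 := Nat.cast_ne_zero.2 hN
  have key : (∑ τ : Fin k, if (past τ).1 h.castSucc = s ∧ (past τ).2 h = a then 1 / β else 0) ≤
      ∑ τ : Fin k, (if (past τ).1 h.castSucc = s ∧ (past τ).2 h = a then
        Real.exp (β * (M.r h s a + V ((past τ).1 h.succ))) else 0) / β := by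
    refine Finset.sum_le_sum fun τ _ => ?_
    split_ifs
    · simpa using exp_div_le_exp_div (β := β) (add_nonneg (M.r_nonneg h s a) (hV _))
    · simp
  rw [sum_ite_visit, ← Finset.sum_div] at key
  rw [weight, mul_div_assoc]
  calc 1 / β = 1 / (visits past h s a : ℝ) * (visits past h s a * (1 / β)) := by field_simp
    _ ≤ _ := mul_le_mul_of_nonneg_left key (by positivity)

theorem deviation_sub_const (M : EpisodicMDP S A H) {k : ℕ} (past : Fin k → Episode S A H)
    (h : Fin H) (s : S) (a : A) (g : S → ℝ) (c : ℝ) :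
    deviation M past h s a (fun x => g x - c) = deviation M past h s a g := by
  simp only [deviation, expect_sub, expect_const, sub_sub_sub_cancel_right]

/-- Uniformity in `V` comes from the `ℓ¹` bound. Subtracting the constant `1` leaves deviations
unchanged and brings the utility within `|β| * expGrowth β (t + 1)`, the factor in the bonus. -/
theorem abs_weight_sub_expBellman_le (M : EpisodicMDP S A H) (β : ℝ) {l : ℝ}
    {k : ℕ} {past : Fin k → Episode S A H} (hc : Concentrated M l past) {V : S → ℝ} {t : ℝ}
    (ht : 0 ≤ t) (hV : ∀ x, V x ∈ Set.Icc 0 t) (h : Fin H) (s : S) (a : A)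
    (hN : visits past h s a ≠ 0) :
    |weight M.r β past V h s a - expBellman M β V h s a| ≤
      |β| * expGrowth β (t + 1) * Real.sqrt (2 * l / visits past h s a) := by
  have hN' : (0 : ℝ) < visits past h s a := Nat.cast_pos.2 (Nat.pos_of_ne_zero hN)
  have h1 : weight M.r β past V h s a - expBellman M β V h s a = 1 / (visits past h s a : ℝ) *
      deviation M past h s a (fun x => Real.exp (β * (M.r h s a + V x)) - 1) := by
    have : expBellman M β V h s a = 1 / (visits past h s a : ℝ) *
        ∑ τ : Fin k, if (past τ).1 h.castSucc = s ∧ (past τ).2 h = a then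
          expBellman M β V h s a else 0 := by
      rw [sum_ite_visit]; field_simp
    rw [weight, this, ← mul_sub, ← Finset.sum_sub_distrib, deviation_sub_const, deviation]
    congr 1
    refine Finset.sum_congr rfl fun τ _ => ?_
    split_ifs
    · rfl
    · simp
  have h2 : |deviation M past h s a (fun x => Real.exp (β * (M.r h s a + V x)) - 1)| ≤
      |β| * expGrowth β (t + 1) * Real.sqrt (2 * l * visits past h s a) := by
    refine abs_deviation_le M past h s a
      (mul_nonneg (abs_nonneg β) (expGrowth_nonneg β (by linarith))) (hc h s a) fun x => ?_
    have h3 : 0 ≤ M.r h s a + V x := add_nonneg (M.r_nonneg h s a) (hV x).1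
    rw [abs_exp_sub_one β h3]
    refine mul_le_mul_of_nonneg_left ?_ (abs_nonneg β)
    have := exp_div_le_exp_div (β := β)
      (show M.r h s a + V x ≤ t + 1 by linarith [M.r_le_one h s a, (hV x).2])
    rw [expGrowth, expGrowth, sub_div, sub_div]
    linarith
  rw [h1, abs_mul, abs_of_pos (one_div_pos.2 hN')]
  refine (mul_le_mul_of_nonneg_left h2 (one_div_pos.2 hN').le).trans_eq ?_
  have h4 : Real.sqrt (2 * l * visits past h s a) =
      visits past h s a * Real.sqrt (2 * l / visits past h s a) := by
    rw [show 2 * l * (visits past h s a : ℝ) =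
      (visits past h s a : ℝ) ^ 2 * (2 * l / visits past h s a) by field_simp,
      Real.sqrt_mul (sq_nonneg _), Real.sqrt_sq hN'.le]
  rw [h4]
  field_simp

/-- The optimistic estimate never exceeds the maximal exponential utility and lies above the
exponential Bellman operator, by at most the width of the confidence interval. All inequalities are
scaled by `1 / β`, which makes them independent of the sign of `β`. -/
theorem estG_bounds (M : EpisodicMDP S A H) {β δ : ℝ} (hβ : β ≠ 0) {K : ℕ} {k : ℕ}
    {past : Fin k → Episode S A H}
    (hc : Concentrated M (9 / 2 * (Fintype.card S * logFactor S A H K δ)) past)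
    {V : S → ℝ} {t : ℝ} (ht : 0 ≤ t) (hV : ∀ x, V x ∈ Set.Icc 0 t) (h : Fin H)
    (hh : (H : ℝ) - (h : ℕ) = t + 1) (s : S) (a : A) :
    0 < estG M.r 3 β δ K past V h s a ∧
    estG M.r 3 β δ K past V h s a / β ≤ Real.exp (β * (t + 1)) / β ∧
    expBellman M β V h s a / β ≤ estG M.r 3 β δ K past V h s a / β ∧
    estG M.r 3 β δ K past V h s a / β ≤ expBellman M β V h s a / β + expGrowth β (t + 1) *
      width (9 / 2 * (Fintype.card S * logFactor S A H K δ)) past h s a := by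
  have hB := expBellman_div_mem_Icc M β hV h s a
  have hsub : Real.exp (β * (t + 1)) / β = 1 / β + expGrowth β (t + 1) := by
    rw [expGrowth]; ring
  have hg := expGrowth_nonneg β (show 0 ≤ t + 1 by linarith)
  by_cases hN : visits past h s a = 0
  · have hG : estG M.r 3 β δ K past V h s a = Real.exp (β * (t + 1)) := by
      rw [estG, if_pos hN, hh]
    rw [hG, width, if_pos hN, mul_one]
    exact ⟨Real.exp_pos _, le_rfl, hB.2, by linarith [hB.1]⟩
  · have hw := one_div_le_weight_div M β past (fun x => (hV x).1) h s a hN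
    have hd := abs_weight_sub_expBellman_le M β hc ht hV h s a hN
    set l := 9 / 2 * (Fintype.card S * logFactor S A H K δ) with hl
    set q := Real.sqrt (2 * l / visits past h s a) with hq
    have hb : bonus 3 β δ K past h s a = |β| * expGrowth β (t + 1) * q := by
      -- The bonus constant `3` is `√(2 * (9 / 2))`.
      have e : Real.sqrt (2 * l / visits past h s a) = 3 * Real.sqrt ((Fintype.card S : ℝ) *
          logFactor S A H K δ / visits past h s a) := by
        rw [show 2 * l / visits past h s a = 3 ^ 2 * ((Fintype.card S : ℝ) *
          logFactor S A H K δ / visits past h s a) by rw [hl]; ring,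
          Real.sqrt_mul (by norm_num), Real.sqrt_sq (by norm_num)]
      rw [hq, e, bonus, hh, abs_exp_sub_one β (by linarith), logFactor]
      ring
    have hq0 : 0 ≤ q := Real.sqrt_nonneg _
    have hgq := mul_nonneg hg hq0
    set w := weight M.r β past V h s a
    set B := expBellman M β V h s a
    set E := Real.exp (β * (t + 1)) with hE
    rw [width, if_neg hN, ← hq]
    -- Truncation keeps the gap below the whole range `E / β - 1 / β`; without it the gap is at most
    -- twice the bonus. Hence the minimum in `width`.
    have hmin : ∀ x, x ≤ E / β → x ≤ B / β + 2 * (expGrowth β (t + 1) * q) →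
        x ≤ B / β + expGrowth β (t + 1) * min 1 (2 * q) := fun x h1 h2 => by
      rcases min_choice 1 (2 * q) with h | h <;> rw [h]
      · linarith [hB.1]
      · linarith
    -- For `β < 0`, division by `β` reverses order, so the subtracted bonus and the `max` act as an
    -- added bonus and a `min`.
    rcases lt_or_gt_of_ne hβ with hneg | hpos
    · have hG : estG M.r 3 β δ K past V h s a =
          max (w - |β| * expGrowth β (t + 1) * q) E := by
        rw [estG, if_neg hN, if_neg (not_lt.2 hneg.le), hb, hh]
      rw [abs_of_neg hneg] at hd hG
      have hd' := abs_le.1 hd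
      rw [hG]
      refine ⟨(Real.exp_pos _).trans_le (le_max_right _ _),
        (div_le_div_right_of_neg hneg).2 (le_max_right _ _), (div_le_div_right_of_neg hneg).2
          (max_le (by linarith [hd'.2]) ((div_le_div_right_of_neg hneg).1 hB.2)),
        hmin _ ((div_le_div_right_of_neg hneg).2 (le_max_right _ _)) ?_⟩
      calc _ ≤ (w - -β * expGrowth β (t + 1) * q) / β :=
            (div_le_div_right_of_neg hneg).2 (le_max_left _ _)
        _ ≤ (B - 2 * (-β * expGrowth β (t + 1) * q)) / β :=
            (div_le_div_right_of_neg hneg).2 (by linarith [hd'.1])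
        _ = _ := by field_simp; ring
    · have hG : estG M.r 3 β δ K past V h s a =
          min (w + |β| * expGrowth β (t + 1) * q) E := by
        rw [estG, if_neg hN, if_pos hpos, hb, hh]
      rw [abs_of_pos hpos] at hd hG
      have hd' := abs_le.1 hd
      have hw1 : 1 ≤ w := (div_le_div_iff_of_pos_right hpos).1 hw
      rw [hG]
      refine ⟨lt_min (by nlinarith) (Real.exp_pos _),
        (div_le_div_iff_of_pos_right hpos).2 (min_le_right _ _),
        (div_le_div_iff_of_pos_right hpos).2
          (le_min (by linarith [hd'.1]) ((div_le_div_iff_of_pos_right hpos).1 hB.2)),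
        hmin _ ((div_le_div_iff_of_pos_right hpos).2 (min_le_right _ _)) ?_⟩
      calc _ ≤ (w + β * expGrowth β (t + 1) * q) / β :=
            (div_le_div_iff_of_pos_right hpos).2 (min_le_left _ _)
        _ ≤ (B + 2 * (β * expGrowth β (t + 1) * q)) / β :=
            (div_le_div_iff_of_pos_right hpos).2 (by linarith [hd'.2])
        _ = _ := by field_simp

end Estimates

/-! ### Optimism and the regret of one episode. -/

section Optimism

variable {S A : Type*} [Fintype S] [DecidableEq S] [Fintype A] [DecidableEq A] [Nonempty A] {H : ℕ}

theorem estG_log_le_estV (M : EpisodicMDP S A H) (c β δ : ℝ) (K : ℕ) {k : ℕ}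
    (past : Fin k → Episode S A H) (n h : ℕ) (hn : h + (n + 1) = H) (s : S) (a : A) :
    (1 / β) * Real.log (estG M.r c β δ K past (estV M.r c β δ K past n (h + 1) (by omega))
      ⟨h, by omega⟩ s a) ≤ estV M.r c β δ K past (n + 1) h hn s := by
  rw [estV]
  exact Finset.le_sup' (fun a : A => (1 / β) * Real.log (estG M.r c β δ K past
    (estV M.r c β δ K past n (h + 1) (by omega)) ⟨h, by omega⟩ s a)) (Finset.mem_univ a)

theorem horizon_sub {n h : ℕ} (hn : h + (n + 1) = H) : (H : ℝ) - (h : ℕ) = n + 1 := by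
  rw [← hn]; push_cast; ring

/-- The upper bound is the truncation; the lower bound comes from optimism, as the Bellman operator
divided by `β` is at least `1 / β`. It supplies the range of `V` that `estG_bounds` asks for at the
preceding step. -/
theorem estV_mem_Icc (M : EpisodicMDP S A H) {β δ : ℝ} (hβ : β ≠ 0) {K k : ℕ}
    {past : Fin k → Episode S A H}
    (hc : Concentrated M (9 / 2 * (Fintype.card S * logFactor S A H K δ)) past) (n h : ℕ)
    (hn : h + n = H) (s : S) : estV M.r 3 β δ K past n h hn s ∈ Set.Icc (0 : ℝ) n := by
  induction n generalizing h s with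
  | zero => simp [estV]
  | succ n ih =>
    have key := fun a => estG_bounds M hβ hc (Nat.cast_nonneg n)
      (fun x => ih (h + 1) (by omega) x) ⟨h, by omega⟩ (horizon_sub hn) s a
    push_cast
    constructor
    · obtain ⟨a⟩ := ‹Nonempty A›
      refine le_trans ?_ (estG_log_le_estV M 3 β δ K past n h hn s a)
      refine le_of_exp_div_le_exp_div hβ ?_
      rw [exp_mul_inv_mul_log hβ (key a).1, mul_zero, Real.exp_zero]
      exact (expBellman_div_mem_Icc M β (fun x => ih (h + 1) (by omega) x) ⟨h, by omega⟩ s a).1.trans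
        (key a).2.2.1
    · rw [estV]
      refine Finset.sup'_le _ _ fun a _ => le_of_exp_div_le_exp_div hβ ?_
      rw [exp_mul_inv_mul_log hβ (key a).1]
      exact (key a).2.1

/-- Same action, kernel and reward on both sides, so the gap passes linearly to the next step. It
drives both optimism and the upper bound on the gap. -/
theorem expBellman_sub_expValue (M : EpisodicMDP S A H) (β : ℝ) (π : Policy S A H) (n h : ℕ)
    (hn : h + (n + 1) = H) (V : S → ℝ) (s : S) :
    expBellman M β V ⟨h, by omega⟩ s (π ⟨h, by omega⟩ s) / β -
        expValue M β π (n + 1) h hn s / β =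
      expect (M.P ⟨h, by omega⟩ s (π ⟨h, by omega⟩ s)) fun x =>
        Real.exp (β * M.r ⟨h, by omega⟩ s (π ⟨h, by omega⟩ s)) *
          (Real.exp (β * V x) / β - expValue M β π n (h + 1) (by omega) x / β) := by
  rw [expBellman, expValue_succ]
  simp only [div_eq_inv_mul]
  rw [← expect_const_mul, ← expect_const_mul, ← expect_sub]
  refine congrArg _ (funext fun x => ?_)
  rw [mul_add, Real.exp_add]
  ring

/-- The estimated values are optimistic: they dominate the values of all policies. -/
theorem expValue_le_exp_estV (M : EpisodicMDP S A H) {β δ : ℝ} (hβ : β ≠ 0) {K k : ℕ}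
    {past : Fin k → Episode S A H}
    (hc : Concentrated M (9 / 2 * (Fintype.card S * logFactor S A H K δ)) past)
    (π : Policy S A H) (n h : ℕ) (hn : h + n = H) (s : S) :
    expValue M β π n h hn s / β ≤ Real.exp (β * estV M.r 3 β δ K past n h hn s) / β := by
  induction n generalizing h s with
  | zero => simp [estV, expValue_zero]
  | succ n ih =>
    set V := estV M.r 3 β δ K past n (h + 1) (by omega) with hV
    have hG := estG_bounds M hβ hc (Nat.cast_nonneg n)
      (fun x => estV_mem_Icc M hβ hc n (h + 1) (by omega) x) ⟨h, by omega⟩ (horizon_sub hn) s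
      (π ⟨h, by omega⟩ s)
    have h1 := expBellman_sub_expValue M β π n h hn V s
    have h2 := exp_div_le_exp_div (β := β)
      (estG_log_le_estV M 3 β δ K past n h hn s (π ⟨h, by omega⟩ s))
    rw [exp_mul_inv_mul_log hβ hG.1] at h2
    have h3 : 0 ≤ expBellman M β V ⟨h, by omega⟩ s (π ⟨h, by omega⟩ s) / β -
        expValue M β π (n + 1) h hn s / β := by
      rw [h1]
      exact expect_nonneg fun x => mul_nonneg (Real.exp_pos _).le
        (sub_nonneg.2 (ih (h + 1) (by omega) x))
    linarith [hG.2.2.1]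

theorem estV_succ_eq (M : EpisodicMDP S A H) (c β δ : ℝ) (K : ℕ) {k : ℕ}
    (past : Fin k → Episode S A H) {π : Policy S A H}
    (hπ : ∀ h s a, estQ M.r c β δ K past h s a ≤ estQ M.r c β δ K past h s (π h s))
    (n h : ℕ) (hn : h + (n + 1) = H) (s : S) :
    estV M.r c β δ K past (n + 1) h hn s = (1 / β) * Real.log (estG M.r c β δ K past
      (estV M.r c β δ K past n (h + 1) (by omega)) ⟨h, by omega⟩ s (π ⟨h, by omega⟩ s)) := by
  refine le_antisymm ?_ (estG_log_le_estV M c β δ K past n h hn s _)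
  rw [estV]
  refine Finset.sup'_le _ _ fun a _ => ?_
  -- `estQ` expresses the number of remaining steps as `H - (h + 1)`.
  obtain rfl : n = H - (h + 1) := by omega
  exact hπ ⟨h, by omega⟩ s a

/-- The expected sum of the widths along an episode from step `h` on. -/
noncomputable def expectedWidth (M : EpisodicMDP S A H) (l : ℝ) {k : ℕ}
    (past : Fin k → Episode S A H) (π : Policy S A H) (n h : ℕ) (hn : h + n = H) (s : S) : ℝ :=
  expect (pathLaw M π n h hn s) fun x => ∑ i : Fin n,
    width l past ⟨h + i, by omega⟩ (x i.castSucc) (π ⟨h + i, by omega⟩ (x i.castSucc))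

theorem expectedWidth_nonneg (M : EpisodicMDP S A H) (l : ℝ) {k : ℕ}
    (past : Fin k → Episode S A H) (π : Policy S A H) (n h : ℕ) (hn : h + n = H) (s : S) :
    0 ≤ expectedWidth M l past π n h hn s :=
  expect_nonneg fun _ => Finset.sum_nonneg fun _ _ => width_nonneg _ _ _ _ _

/-- The gap between the estimated exponential value and that of the greedy policy. -/
theorem exp_estV_sub_expValue_le (M : EpisodicMDP S A H) {β δ : ℝ} (hβ : β ≠ 0) {K k : ℕ}
    {past : Fin k → Episode S A H}
    (hc : Concentrated M (9 / 2 * (Fintype.card S * logFactor S A H K δ)) past)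
    {π : Policy S A H}
    (hπ : ∀ h s a, estQ M.r 3 β δ K past h s a ≤ estQ M.r 3 β δ K past h s (π h s))
    (n h : ℕ) (hn : h + n = H) (s : S) :
    Real.exp (β * estV M.r 3 β δ K past n h hn s) / β - expValue M β π n h hn s / β ≤
      expGrowth β n * expectedWidth M (9 / 2 * (Fintype.card S * logFactor S A H K δ))
        past π n h hn s := by
  induction n generalizing h s with
  | zero => simp [estV, expValue_zero, expGrowth]
  | succ n ih =>
    set l := 9 / 2 * (Fintype.card S * logFactor S A H K δ) with hl
    set V := estV M.r 3 β δ K past n (h + 1) (by omega) with hV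
    set a := π ⟨h, by omega⟩ s with ha
    have hG := estG_bounds M hβ hc (Nat.cast_nonneg n)
      (fun x => estV_mem_Icc M hβ hc n (h + 1) (by omega) x) ⟨h, by omega⟩ (horizon_sub hn) s a
    have h1 := expBellman_sub_expValue M β π n h hn V s
    have h2 : expectedWidth M l past π (n + 1) h hn s = width l past ⟨h, by omega⟩ s a +
        expect (M.P ⟨h, by omega⟩ s a) (expectedWidth M l past π n (h + 1) (by omega)) :=
      expect_pathLaw_sum_succ M π (fun h s => width l past h s (π h s)) n h hn s
    rw [estV_succ_eq M 3 β δ K past hπ, exp_mul_inv_mul_log hβ hG.1, h2, mul_add, ← expect_const_mul,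
      Nat.cast_add, Nat.cast_one]
    have h3 : expBellman M β V ⟨h, by omega⟩ s a / β - expValue M β π (n + 1) h hn s / β ≤
        expect (M.P ⟨h, by omega⟩ s a) fun x => expGrowth β (n + 1) *
          expectedWidth M l past π n (h + 1) (by omega) x := by
      rw [h1]
      refine expect_mono fun x => ?_
      calc _ ≤ Real.exp (β * M.r ⟨h, by omega⟩ s a) * (expGrowth β n *
            expectedWidth M l past π n (h + 1) (by omega) x) :=
            mul_le_mul_of_nonneg_left (ih (h + 1) (by omega) x) (Real.exp_pos _).le
        _ ≤ _ := by
            rw [← mul_assoc]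
            exact mul_le_mul_of_nonneg_right
              (exp_mul_expGrowth_le β (M.r_nonneg _ _ _) (M.r_le_one _ _ _))
              (expectedWidth_nonneg _ _ _ _ _ _ _ _)
    linarith [hG.2.2.2]

theorem one_div_le_expValue_div (M : EpisodicMDP S A H) (β : ℝ) (π : Policy S A H) (n h : ℕ)
    (hn : h + n = H) (s : S) : 1 / β ≤ expValue M β π n h hn s / β := by
  have := expect_div_le_div (p := pathLaw M π n h hn s) (β := β) fun x =>
    exp_div_le_exp_div (β := β) (pathReturn_mem_Icc M π n h hn x).1
  simpa [expect_const, expValue] using this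

/-- The logarithm turns a gap of exponential values into a gap of values, at the cost of a factor
`exp (|β| t)` when `β` is negative. -/
theorem sub_log_le {β v t x F : ℝ} (hβ : β ≠ 0) (hvt : v ≤ t) (hx : 0 < x)
    (hx1 : 1 / β ≤ x / β) (hxv : x / β ≤ Real.exp (β * v) / β)
    (hF : Real.exp (β * v) / β - x / β ≤ expGrowth β t * F) :
    v - (1 / β) * Real.log x ≤ (Real.exp (|β| * t) - 1) / |β| * F := by
  have hv : v = (1 / β) * Real.log (Real.exp (β * v)) := by rw [Real.log_exp]; field_simp
  set y := Real.exp (β * v) with hy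
  have hy0 : 0 < y := Real.exp_pos _
  have hnn : 0 ≤ y / β - x / β := sub_nonneg.2 hxv
  rcases lt_or_gt_of_ne hβ with hneg | hpos
  · have h1 : Real.log (x / y) ≤ x / y - 1 := Real.log_le_sub_one_of_pos (by positivity)
    rw [Real.log_div hx.ne' hy0.ne'] at h1
    -- This is the cost of the logarithm; it is absorbed by `exp (-β * t) * expGrowth β t = (exp
    -- (|β| * t) - 1) / |β|`.
    have h2 : y⁻¹ ≤ Real.exp (-β * t) := by
      rw [hy, ← Real.exp_neg]
      exact Real.exp_le_exp.2 (by nlinarith)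
    rw [abs_of_neg hneg]
    calc v - (1 / β) * Real.log x = (1 / -β) * (Real.log x - Real.log y) := by
          rw [hv]; field_simp; ring
      _ ≤ (1 / -β) * (x / y - 1) :=
          mul_le_mul_of_nonneg_left h1 (one_div_pos.2 (neg_pos.2 hneg)).le
      _ = y⁻¹ * (y / β - x / β) := by field_simp; ring
      _ ≤ Real.exp (-β * t) * (expGrowth β t * F) := mul_le_mul h2 hF hnn (Real.exp_pos _).le
      _ = _ := by
          rw [expGrowth, neg_mul, Real.exp_neg]
          field_simp
          ring
  · have hx1' : 1 ≤ x := (div_le_div_iff_of_pos_right hpos).1 hx1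
    have h1 : Real.log (y / x) ≤ y / x - 1 := Real.log_le_sub_one_of_pos (by positivity)
    rw [Real.log_div hy0.ne' hx.ne'] at h1
    rw [abs_of_pos hpos]
    calc v - (1 / β) * Real.log x = (1 / β) * (Real.log y - Real.log x) := by
          rw [hv]; field_simp
      _ ≤ (1 / β) * (y / x - 1) := mul_le_mul_of_nonneg_left h1 (one_div_pos.2 hpos).le
      _ = x⁻¹ * (y / β - x / β) := by field_simp
      _ ≤ 1 * (y / β - x / β) := mul_le_mul_of_nonneg_right (inv_le_one_of_one_le₀ hx1') hnn
      _ ≤ _ := by rw [one_mul]; exact hF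

/-- The regret of one episode. -/
theorem optValue_sub_value_le (M : EpisodicMDP S A H) {β δ : ℝ} (hβ : β ≠ 0) {K k : ℕ}
    {past : Fin k → Episode S A H}
    (hc : Concentrated M (9 / 2 * (Fintype.card S * logFactor S A H K δ)) past)
    {π : Policy S A H}
    (hπ : ∀ h s a, estQ M.r 3 β δ K past h s a ≤ estQ M.r 3 β δ K past h s (π h s))
    (n h : ℕ) (hn : h + n = H) (s : S) :
    optValue M β n h hn s - value M β π n h hn s ≤
      (Real.exp (|β| * n) - 1) / |β| *
        expectedWidth M (9 / 2 * (Fintype.card S * logFactor S A H K δ)) past π n h hn s := by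
  have h1 : optValue M β n h hn s ≤ estV M.r 3 β δ K past n h hn s := by
    refine ciSup_le fun π' => le_of_exp_div_le_exp_div hβ ?_
    rw [value_eq, exp_mul_inv_mul_log hβ (expValue_pos M β π' n h hn s)]
    exact expValue_le_exp_estV M hβ hc π' n h hn s
  have h2 := sub_log_le hβ (estV_mem_Icc M hβ hc n h hn s).2 (expValue_pos M β π n h hn s)
    (one_div_le_expValue_div M β π n h hn s) (expValue_le_exp_estV M hβ hc π n h hn s)
    (exp_estV_sub_expValue_le M hβ hc hπ n h hn s)
  rw [value_eq]
  linarith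

end Optimism

/-! ### Summing the widths over episodes. -/

section Counting

variable {S A : Type*} [Fintype S] [DecidableEq S] [Fintype A] [DecidableEq A] {H : ℕ}

/-- With `u = √n` and `v = √(n + 1)`, `v - u = 1 / (u + v)`, and `v ≤ 2 * u` because `n ≥ 1`. -/
theorem inv_sqrt_le_sqrt_sub (n : ℕ) (hn : n ≠ 0) :
    1 / Real.sqrt n ≤ 3 * (Real.sqrt (n + 1 : ℕ) - Real.sqrt n) := by
  have hn1 : (1 : ℝ) ≤ n := Nat.one_le_cast.2 (Nat.pos_of_ne_zero hn)
  have hu : Real.sqrt n ^ 2 = n := Real.sq_sqrt (by linarith)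
  have hv : Real.sqrt (n + 1 : ℕ) ^ 2 = n + 1 := by
    rw [Real.sq_sqrt (by positivity)]; push_cast; ring
  have hu0 : 0 < Real.sqrt n := Real.sqrt_pos.2 (by linarith)
  have hv0 : 0 ≤ Real.sqrt (n + 1 : ℕ) := Real.sqrt_nonneg _
  set u := Real.sqrt n
  set v := Real.sqrt (n + 1 : ℕ)
  have huv : u ≤ v := by nlinarith
  have hv2 : v ≤ 2 * u := by nlinarith
  rw [div_le_iff₀ hu0]
  nlinarith [mul_nonneg (sub_nonneg.2 huv) (sub_nonneg.2 hv2)]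

/-- The hypothesis `hl` lets the width `1` of an unvisited pair obey the same telescoping bound. -/
theorem width_le (l : ℝ) (hl : 1 ≤ 2 * Real.sqrt (2 * l)) {k : ℕ} (past : Fin k → Episode S A H)
    (h : Fin H) (s : S) (a : A) :
    width l past h s a ≤ 2 * Real.sqrt (2 * l) * (3 * (Real.sqrt (visits past h s a + 1 : ℕ) -
      Real.sqrt (visits past h s a))) := by
  rw [width]
  split_ifs with h0
  · rw [h0, Nat.cast_zero, Real.sqrt_zero, zero_add, Nat.cast_one, Real.sqrt_one]
    linarith
  · refine (min_le_right _ _).trans ?_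
    rw [Real.sqrt_div' _ (Nat.cast_nonneg _), div_eq_mul_one_div (Real.sqrt (2 * l)), ← mul_assoc]
    exact mul_le_mul_of_nonneg_left (inv_sqrt_le_sqrt_sub _ h0) (by linarith)

/-- Telescoping: at step `h` a new episode raises exactly one visit count, by one. -/
theorem sum_width_le_sum_sqrt_visits (l : ℝ) (hl : 1 ≤ 2 * Real.sqrt (2 * l)) {K : ℕ}
    (ω : Fin K → Episode S A H) (h : Fin H) :
    ∑ k : Fin K, width l (pastOf ω k) h ((ω k).1 h.castSucc) ((ω k).2 h) ≤
      2 * Real.sqrt (2 * l) * (3 * ∑ p : S × A, Real.sqrt (visits ω h p.1 p.2)) := by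
  induction K with
  | zero => simp [visits]
  | succ K ih =>
    obtain ⟨past, e, rfl⟩ : ∃ past e, ω = (Fin.snoc past e : Fin (K + 1) → Episode S A H) :=
      ⟨_, _, (Fin.snoc_init_self ω).symm⟩
    simp only [Fin.sum_univ_castSucc, Fin.snoc_castSucc, Fin.snoc_last, pastOf_snoc_castSucc,
      Fin.val_castSucc, visits_snoc]
    have h1 := width_le l hl past h (e.1 h.castSucc) (e.2 h)
    have h2 : Real.sqrt (visits past h (e.1 h.castSucc) (e.2 h) + 1 : ℕ) -
        Real.sqrt (visits past h (e.1 h.castSucc) (e.2 h)) ≤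
        ∑ p : S × A, (Real.sqrt (visits past h p.1 p.2 +
          if e.1 h.castSucc = p.1 ∧ e.2 h = p.2 then 1 else 0 : ℕ) -
            Real.sqrt (visits past h p.1 p.2)) := by
      refine le_trans (le_of_eq ?_) (Finset.single_le_sum (fun p _ => ?_)
        (Finset.mem_univ (e.1 h.castSucc, e.2 h)))
      · simp
      · exact sub_nonneg.2 (Real.sqrt_le_sqrt (Nat.cast_le.2 (Nat.le_add_right _ _)))
    rw [Finset.sum_sub_distrib] at h2
    have h3 : width l (pastOf (Fin.snoc past e : Fin (K + 1) → Episode S A H) (Fin.last K)) h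
        (e.1 h.castSucc) (e.2 h) = width l past h (e.1 h.castSucc) (e.2 h) := by
      have := pastOf_snoc_last past e
      exact congrArg (fun x : Fin K → Episode S A H => width l x h (e.1 h.castSucc) (e.2 h)) this
    have h4 := mul_le_mul_of_nonneg_left h2 (show 0 ≤ 2 * Real.sqrt (2 * l) * 3 by positivity)
    have h5 := ih past
    rw [h3]
    linarith

theorem sum_visits {K : ℕ} (ω : Fin K → Episode S A H) (h : Fin H) :
    ∑ p : S × A, visits ω h p.1 p.2 = K := by
  simp only [visits, Finset.card_filter]
  rw [Finset.sum_comm]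
  have : ∀ τ : Fin K, (∑ p : S × A, if (ω τ).1 h.castSucc = p.1 ∧ (ω τ).2 h = p.2 then 1 else 0) =
      1 := fun τ => by
    rw [Finset.sum_eq_single ((ω τ).1 h.castSucc, (ω τ).2 h)]
    · simp
    · rintro ⟨s, a⟩ _ hp
      exact if_neg fun hh => hp (Prod.ext hh.1.symm hh.2.symm)
    · simp
  simp [this]

/-- Cauchy–Schwarz over the pairs, whose visit counts at step `h` add up to `K`. -/
theorem sum_sqrt_visits_le {K : ℕ} (ω : Fin K → Episode S A H) (h : Fin H) :
    ∑ p : S × A, Real.sqrt (visits ω h p.1 p.2) ≤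
      Real.sqrt (Fintype.card S * Fintype.card A * K) := by
  refine Real.le_sqrt_of_sq_le ((sq_sum_le_card_mul_sum_sq).trans_eq ?_)
  have : ∀ p : S × A, Real.sqrt (visits ω h p.1 p.2) ^ 2 = visits ω h p.1 p.2 := fun p =>
    Real.sq_sqrt (Nat.cast_nonneg _)
  simp only [this, ← Nat.cast_sum, sum_visits]
  simp

/-- The sum of the widths of the confidence intervals met in one episode. -/
noncomputable def episodeWidth (l : ℝ) {k : ℕ} (past : Fin k → Episode S A H)
    (e : Episode S A H) : ℝ :=
  ∑ h : Fin H, width l past h (e.1 h.castSucc) (e.2 h)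

theorem episodeWidth_nonneg (l : ℝ) {k : ℕ} (past : Fin k → Episode S A H)
    (e : Episode S A H) : 0 ≤ episodeWidth l past e :=
  Finset.sum_nonneg fun _ _ => width_nonneg _ _ _ _ _

theorem episodeWidth_le (l : ℝ) {k : ℕ} (past : Fin k → Episode S A H)
    (e : Episode S A H) : episodeWidth l past e ≤ H :=
  (Finset.sum_le_sum fun _ _ => width_le_one _ _ _ _ _).trans_eq (by simp)

theorem expectedWidth_eq (M : EpisodicMDP S A H) (l : ℝ) {k : ℕ} (past : Fin k → Episode S A H)
    (π : Policy S A H) (s₁ : S) : expectedWidth M l past π H 0 (Nat.zero_add H) s₁ =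
      expect (episodeLaw M π s₁) (episodeWidth l past) := by
  rw [expect_episodeLaw, expectedWidth]
  simp only [Nat.zero_add]
  rfl

theorem sum_episodeWidth_le (l : ℝ) (hl : 1 ≤ 2 * Real.sqrt (2 * l)) {K : ℕ}
    (ω : Fin K → Episode S A H) :
    ∑ k : Fin K, episodeWidth l (pastOf ω k) (ω k) ≤
      H * (6 * Real.sqrt (2 * l) * Real.sqrt (Fintype.card S * Fintype.card A * K)) := by
  simp only [episodeWidth]
  rw [Finset.sum_comm]
  refine (Finset.sum_le_sum fun h _ => (sum_width_le_sum_sqrt_visits l hl ω h).trans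
    (mul_le_mul_of_nonneg_left (mul_le_mul_of_nonneg_left (sum_sqrt_visits_le ω h)
      zero_le_three) (by positivity))).trans_eq ?_
  simp only [Finset.sum_const, Finset.card_univ, Fintype.card_fin, nsmul_eq_mul]
  ring

/-- Dividing by `H` puts episode widths in `[0, 1]`. The multiplicative bound loses a factor `2`,
but its additive term does not grow with `K`. -/
theorem prob_sum_expectedWidth_le (M : EpisodicMDP S A H) (L : LearningRule S A H) (s₁ : S)
    (l : ℝ) (hH : 0 < H) (K : ℕ) (x : ℝ) :
    prob (runLaw M L s₁ K) {ω | 2 * ∑ k : Fin K, episodeWidth l (pastOf ω k) (ω k) + 2 * H * x ≤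
      ∑ k : Fin K, expectedWidth M l (pastOf ω k) (L k (pastOf ω k)) H 0 (Nat.zero_add H) s₁} ≤
      Real.exp (-x) := by
  have hH' : (0 : ℝ) < H := Nat.cast_pos.2 hH
  refine le_trans (prob_mono fun ω hω => ?_) (prob_sum_expect_le M L s₁
    (fun k past e => (H : ℝ)⁻¹ * episodeWidth l past e)
    (fun k past e => mul_nonneg (by positivity) (episodeWidth_nonneg l past e))
    (fun k past e => by
      rw [inv_mul_le_iff₀ hH', mul_one]; exact episodeWidth_le l past e) K x)
  have hω' : 2 * ∑ k : Fin K, episodeWidth l (pastOf ω k) (ω k) + 2 * H * x ≤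
      ∑ k : Fin K, expectedWidth M l (pastOf ω k) (L k (pastOf ω k)) H 0 (Nat.zero_add H) s₁ := hω
  simp only [Set.mem_ofPred_eq, expect_const_mul, ← expectedWidth_eq]
  rw [Finset.sum_sub_distrib, ← Finset.sum_div, ← Finset.mul_sum, ← Finset.mul_sum,
    mul_div_assoc, ← mul_sub, ← div_eq_inv_mul, le_div_iff₀ hH']
  linarith

end Counting

/-! ### Failure probability, constants and the final bound. -/

section Regret

variable {S A : Type*} [Fintype S] [DecidableEq S] [Fintype A] [DecidableEq A] [Nonempty A] {H : ℕ}

theorem optValue_sub_value_of_subsingleton [Subsingleton A] (M : EpisodicMDP S A H) (β : ℝ)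
    (π : Policy S A H) (n h : ℕ) (hn : h + n = H) (s : S) :
    optValue M β n h hn s - value M β π n h hn s ≤ 0 := by
  refine sub_nonpos.2 (ciSup_le fun π' => ?_)
  rw [Subsingleton.elim π' π]

/-- The failure probabilities of the two concentration events sum up to at most `δ`. -/
theorem failure_prob_le {K s n : ℕ} (hs : 0 < s) (hK : K ≤ n) (hn : 2 ≤ n)
    {δ : ℝ} (h0 : 0 < δ) (h1 : δ ≤ 1) :
    (K * n * 2 ^ s : ℝ) * Real.exp (-(9 / 2 * (s * Real.log (n / δ)))) +
      Real.exp (-(2 * Real.log (n / δ))) ≤ δ := by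
  have hn' : (2 : ℝ) ≤ n := by exact_mod_cast hn
  have hK' : (K : ℝ) ≤ n := by exact_mod_cast hK
  have hs' : (1 : ℝ) ≤ s := by exact_mod_cast hs
  have hL : 0 ≤ Real.log (n / δ) :=
    Real.log_nonneg ((one_le_div h0).2 (by linarith))
  have hy : Real.exp (-Real.log (n / δ)) = δ / n := by
    rw [Real.exp_neg, Real.exp_log (by positivity), inv_div]
  set y := δ / n with hydef
  have hy0 : 0 < y := by positivity
  have hny : n * y = δ := by rw [hydef]; field_simp
  have hyδ : y ≤ δ / 2 := div_le_div_of_nonneg_left h0.le two_pos hn'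
  have e2 : Real.exp (-(2 * Real.log (n / δ))) = y ^ 2 := by
    rw [← hy, ← Real.exp_nat_mul]; congr 1; push_cast; ring
  -- Since `s ≥ 1`, `9 / 2 * s ≥ s + 3`: the `s` factors `y ≤ 1 / 2` offset the `2 ^ s` sign
  -- functions, and `y ^ 3` pays for the rest of the union bound.
  have e1 : Real.exp (-(9 / 2 * (s * Real.log (n / δ)))) ≤ (1 / 2) ^ s * y ^ 3 := by
    calc _ ≤ Real.exp (-Real.log (n / δ)) ^ s * Real.exp (-Real.log (n / δ)) ^ 3 := by
          rw [← Real.exp_nat_mul, ← Real.exp_nat_mul, ← Real.exp_add]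
          refine Real.exp_le_exp.2 ?_
          push_cast
          nlinarith [mul_le_mul_of_nonneg_right hs' hL]
      _ ≤ _ := by
          rw [hy]
          gcongr
          linarith
  have e3 : (K * n * 2 ^ s : ℝ) * ((1 / 2) ^ s * y ^ 3) = K * n * y ^ 3 := by
    have : (2 : ℝ) ^ s * (1 / 2) ^ s = 1 := by rw [← mul_pow]; norm_num
    linear_combination (K * n * y ^ 3 : ℝ) * this
  have e4 : (K * n * y ^ 3 : ℝ) ≤ δ ^ 2 * y := by
    rw [← hny]
    calc (K * n * y ^ 3 : ℝ) ≤ n * n * y ^ 3 := by gcongr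
      _ = _ := by ring
  have e5 := mul_le_mul_of_nonneg_left e1 (show (0 : ℝ) ≤ K * n * 2 ^ s by positivity)
  rw [e3] at e5
  rw [e2]
  nlinarith

theorem regret_le (M : EpisodicMDP S A H) {β δ : ℝ} (hβ : β ≠ 0) {K : ℕ}
    {L : LearningRule S A H} (hL : IsRSVI2 M.r 3 β δ K L) (s₁ : S) {ω : Fin K → Episode S A H}
    (hc : ∀ k, Concentrated M (9 / 2 * (Fintype.card S * logFactor S A H K δ)) (pastOf ω k)) :
    regret M β L s₁ ω ≤ (Real.exp (|β| * H) - 1) / |β| * ∑ k : Fin K,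
      expectedWidth M (9 / 2 * (Fintype.card S * logFactor S A H K δ)) (pastOf ω k)
        (L k (pastOf ω k)) H 0 (Nat.zero_add H) s₁ := by
  rw [regret, Finset.mul_sum]
  -- `policyOf L ω k` unfolds to `L k (pastOf ω k)`.
  exact Finset.sum_le_sum fun k _ =>
    optValue_sub_value_le M hβ (hc k) (hL k (pastOf ω k)) H 0 (Nat.zero_add H) s₁

/-- The bound holds from `16 / 25` on, and `log 2 > 0.69`. It trades `√x` for the full logarithm in
the regret bound. -/
theorem sqrt_log_le {x : ℝ} (hx : Real.log 2 ≤ x) : Real.sqrt x ≤ 5 / 4 * x := by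
  have := Real.log_two_gt_d9
  rw [Real.sqrt_le_left (by linarith)]
  nlinarith

/-- The numerical estimate behind the regret bound. -/
theorem width_bound_le {H s a K x : ℝ} (hH : 0 ≤ H) (hs : 1 ≤ s) (ha : 1 ≤ a) (hK : 1 ≤ K)
    (hx : Real.log 2 ≤ x) :
    2 * (H * (6 * Real.sqrt (2 * (9 / 2 * (s * x))) * Real.sqrt (s * a * K))) + 2 * H * (2 * x) ≤
      50 * H * (s * Real.sqrt (a * K) * x) := by
  have hl2 := Real.log_two_gt_d9
  have hx0 : 0 < x := by linarith
  have e1 : Real.sqrt (2 * (9 / 2 * (s * x))) * Real.sqrt (s * a * K) =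
      3 * s * Real.sqrt (a * K) * Real.sqrt x := by
    rw [← Real.sqrt_mul (by positivity),
      show 2 * (9 / 2 * (s * x)) * (s * a * K) = (3 * s) ^ 2 * ((a * K) * x) by ring,
      Real.sqrt_mul (by positivity), Real.sqrt_sq (by positivity), Real.sqrt_mul (by positivity)]
    ring
  have e2 : 1 ≤ s * Real.sqrt (a * K) :=
    one_le_mul_of_one_le_of_one_le hs (Real.one_le_sqrt.2 (one_le_mul_of_one_le_of_one_le ha hK))
  have e3 := sqrt_log_le hx
  calc _ = H * (36 * (s * Real.sqrt (a * K)) * Real.sqrt x + 4 * x) := by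
        rw [mul_assoc 6, e1]; ring
    _ ≤ H * (36 * (s * Real.sqrt (a * K)) * (5 / 4 * x) + 4 * (s * Real.sqrt (a * K) * x)) := by
        have : x ≤ s * Real.sqrt (a * K) * x := le_mul_of_one_le_left hx0.le e2
        gcongr
    _ ≤ _ := by
        -- The total constant is `36 * 5 / 4 + 4 = 49`.
        have : 0 ≤ H * (s * Real.sqrt (a * K) * x) := by positivity
        linarith

/-- The regret bound in the nondegenerate case. -/
theorem prob_regret_le (M : EpisodicMDP S A H) {β δ : ℝ} (hβ : β ≠ 0) {K : ℕ} (hH : 0 < H)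
    (hK : 0 < K) (hn : 2 ≤ H * Fintype.card S * Fintype.card A * K) (h0 : 0 < δ) (h1 : δ ≤ 1)
    {L : LearningRule S A H} (hL : IsRSVI2 M.r 3 β δ K L) (s₁ : S) :
    ENNReal.ofReal (1 - δ) ≤ (runLaw M L s₁ K).toOuterMeasure {ω | regret M β L s₁ ω ≤
      50 * ((Real.exp (|β| * H) - 1) / (|β| * H)) *
        Real.sqrt ((H : ℝ) ^ 4 * (Fintype.card S : ℝ) ^ 2 * Fintype.card A * K *
          Real.log ((H : ℝ) * Fintype.card S * Fintype.card A * K / δ) ^ 2)} := by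
  have : Nonempty S := ⟨s₁⟩
  have hS0 : 0 < Fintype.card S := Fintype.card_pos
  have hA0 : 0 < Fintype.card A := Fintype.card_pos
  have hH' : (0 : ℝ) < H := Nat.cast_pos.2 hH
  have hS' : (1 : ℝ) ≤ Fintype.card S := Nat.one_le_cast.2 hS0
  have hA' : (1 : ℝ) ≤ Fintype.card A := Nat.one_le_cast.2 hA0
  have hK' : (1 : ℝ) ≤ K := Nat.one_le_cast.2 hK
  have hn' : (2 : ℝ) ≤ (H : ℝ) * Fintype.card S * Fintype.card A * K := by exact_mod_cast hn
  set x := logFactor S A H K δ with hx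
  have hx2 : Real.log 2 ≤ x :=
    Real.log_le_log two_pos ((le_div_iff₀ h0).2 (by linarith))
  have hx0 : 0 < x := (Real.log_pos one_lt_two).trans_le hx2
  set l := 9 / 2 * (Fintype.card S * x) with hl
  refine ofReal_one_sub_le_toOuterMeasure
    (t := {ω | ∃ k : Fin K, ¬ Concentrated M l (pastOf ω k)} ∪
      {ω | 2 * ∑ k : Fin K, episodeWidth l (pastOf ω k) (ω k) + 2 * H * (2 * x) ≤
        ∑ k : Fin K, expectedWidth M l (pastOf ω k) (L k (pastOf ω k)) H 0 (Nat.zero_add H) s₁})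
    ?_ fun ω hω => ?_
  · refine (prob_union_le _ _ _).trans ((add_le_add
      (prob_not_concentrated_le M L s₁ K (by positivity))
      (prob_sum_expectedWidth_le M L s₁ l hH K (2 * x))).trans ?_)
    have hKn : K ≤ H * Fintype.card S * Fintype.card A * K :=
      Nat.le_mul_of_pos_left K (by positivity)
    refine le_of_eq_of_le ?_ (failure_prob_le hS0 hKn hn h0 h1)
    rw [hl, hx, logFactor]
    push_cast
    ring
  · simp only [Set.mem_union, Set.mem_ofPred_eq, not_or, not_exists, not_not, not_le] at hω
    have hl1 : 1 ≤ 2 * Real.sqrt (2 * l) := by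
      have : 1 ≤ Real.sqrt (2 * l) := Real.one_le_sqrt.2 (by
        have := Real.log_two_gt_d9
        nlinarith [mul_le_mul_of_nonneg_right hS' hx0.le])
      linarith
    have hG : 0 ≤ (Real.exp (|β| * H) - 1) / |β| :=
      div_nonneg (sub_nonneg.2 (Real.one_le_exp (by positivity))) (abs_nonneg β)
    have hsum := sum_episodeWidth_le l hl1 ω
    have hb := width_bound_le hH'.le hS' hA' hK' hx2
    have hsqrt : Real.sqrt ((H : ℝ) ^ 4 * (Fintype.card S : ℝ) ^ 2 * Fintype.card A * K *
        Real.log ((H : ℝ) * Fintype.card S * Fintype.card A * K / δ) ^ 2) =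
        H ^ 2 * (Fintype.card S * Real.sqrt (Fintype.card A * K) * x) := by
      rw [show Real.log ((H : ℝ) * Fintype.card S * Fintype.card A * K / δ) = x from rfl,
        show (H : ℝ) ^ 4 * (Fintype.card S : ℝ) ^ 2 * Fintype.card A * K * x ^ 2 =
          (H ^ 2 * Fintype.card S * x) ^ 2 * (Fintype.card A * K) by ring,
        Real.sqrt_mul (by positivity), Real.sqrt_sq (by positivity)]
      ring
    have hβ' : |β| ≠ 0 := abs_ne_zero.2 hβ
    calc regret M β L s₁ ω ≤ _ := regret_le M hβ hL s₁ hω.1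
      _ ≤ (Real.exp (|β| * H) - 1) / |β| *
          (50 * H * (Fintype.card S * Real.sqrt (Fintype.card A * K) * x)) :=
        mul_le_mul_of_nonneg_left (by linarith [hω.2]) hG
      _ = _ := by
        rw [hsqrt]
        field_simp

end Regret

end RiskRL

theorem theorem1 :
    ∃ c C : ℝ, 0 < c ∧ 0 < C ∧
      ∀ (S A : Type*) [Fintype S] [DecidableEq S] [Fintype A] [DecidableEq A] [Nonempty A]
        (H K : ℕ) (_ : 0 < H) (_ : 0 < K)
        (M : RiskRL.EpisodicMDP S A H) (s₁ : S)
        (β : ℝ) (_ : β ≠ 0) (δ : ℝ) (_ : 0 < δ) (_ : δ ≤ 1)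
        (L : RiskRL.LearningRule S A H) (_ : RiskRL.IsRSVI2 M.r c β δ K L),
        ENNReal.ofReal (1 - δ) ≤ (RiskRL.runLaw M L s₁ K).toOuterMeasure
          {ω | RiskRL.regret M β L s₁ ω ≤
            C * ((Real.exp (|β| * H) - 1) / (|β| * H)) *
              Real.sqrt ((H : ℝ) ^ 4 * (Fintype.card S : ℝ) ^ 2 * Fintype.card A * K *
                Real.log ((H : ℝ) * Fintype.card S * Fintype.card A * K / δ) ^ 2)} := by
  refine ⟨3, 50, by norm_num, by norm_num, ?_⟩
  intro S A _ _ _ _ _ H K hH hK M s₁ β hβ δ h0 h1 L hL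
  have : Nonempty S := ⟨s₁⟩
  have hS0 : 0 < Fintype.card S := Fintype.card_pos
  have hA0 : 0 < Fintype.card A := Fintype.card_pos
  -- The main argument needs the logarithm to be at least `log 2`, which can fail when the product
  -- is `1`. Then there is only one action, so the regret is nonpositive.
  by_cases hn : 2 ≤ H * Fintype.card S * Fintype.card A * K
  · exact RiskRL.prob_regret_le M hβ hH hK hn h0 h1 hL s₁
  · have hpos : 0 < H * Fintype.card S * Fintype.card A * K := by positivity
    have hone : H * Fintype.card S * Fintype.card A * K = 1 := by omega
    have hA1 : Fintype.card A = 1 := (mul_eq_one.1 (mul_eq_one.1 hone).1).2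
    have : Subsingleton A := Fintype.card_le_one_iff_subsingleton.1 hA1.le
    refine RiskRL.ofReal_one_sub_le_toOuterMeasure (t := ∅) ?_ fun ω _ => ?_
    · rw [RiskRL.prob, Set.indicator_empty]
      exact (RiskRL.expect_const _ 0).trans_le h0.le
    · refine le_trans (Finset.sum_nonpos fun k _ =>
        RiskRL.optValue_sub_value_of_subsingleton M β _ H 0 (Nat.zero_add H) s₁) ?_
      have hG : 0 ≤ (Real.exp (|β| * H) - 1) / (|β| * H) :=
        div_nonneg (sub_nonneg.2 (Real.one_le_exp (by positivity))) (by positivity)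
      positivity
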